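/- Let $\ell^2(\mathbb N)$ be the Hilbert space of square-summable complex sequences, let $\mathcal B(\ell^2(\mathbb N))$ be the algebra of bounded linear operators on it, and let $D\subset\mathcal B(\ell^2(\mathbb N))$ be the algebra of diagonal operators, i.e. the image of $\ell^\infty(\mathbb N)$ acting by $(x_n)_n\mapsto(a_nx_n)_n$ for $(a_n)_n\in\ell^\infty(\mathbb N)$. For a unital $C^*$-algebra $A$ of bounded operators, a state on $A$ is a continuous linear functional $\varphi:A\to\mathbb C$ such that $\varphi(x^*x)\ge 0$ for every $x\in A$ and $\varphi(1)=1$; a state is pure if it is an extreme point of the convex set of all states on $A$. **Theorem (positive answer to the Kadison–Singer problem).** Every pure state $\varphi$ on $D$ has a unique extension to a state on $\mathcal B(\ell^2(\mathbb N))$: there is exactly one state $\psi$ on $\mathcal B(\ell^2(\mathbb N))$ with $\psi|_D=\varphi$. Moreover, this $\psi$ is a pure state on $\mathcal B(\ell^2(\mathbb N))$. -/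

import Mathlib

open scoped ENNReal ComplexOrder lp

noncomputable section

/-- The states of a unital `*`-algebra `A` of bounded operators: continuous linear functionals `φ`
with `φ (x* x) ≥ 0` for all `x` (the order of `ℂ`: real and nonnegative) and `φ 1 = 1`. -/
def stateSpace (A : Type*) [Ring A] [StarRing A] [Algebra ℂ A] [TopologicalSpace A] :
    Set (A →L[ℂ] ℂ) :=
  {φ | (∀ x : A, 0 ≤ φ (star x * x)) ∧ φ 1 = 1}

/-- The pure states of `A`: the extreme points of its state space. -/
def pureStates (A : Type*) [Ring A] [StarRing A] [Algebra ℂ A] [TopologicalSpace A] :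
    Set (A →L[ℂ] ℂ) :=
  (stateSpace A).extremePoints ℝ

/-- The Hilbert space `ℓ²(ℕ)` of square-summable complex sequences. -/
abbrev HilbertL2 : Type := ℓ²(ℕ, ℂ)

/-- The algebra `B(ℓ²(ℕ))` of bounded linear operators, with the operator norm and the adjoint. -/
abbrev BoundedOps : Type := HilbertL2 →L[ℂ] HilbertL2

theorem norm_mul_apply_le (a : ℓ^∞(ℕ, ℂ)) (x : HilbertL2) (n : ℕ) :
    ‖a n * x n‖ ≤ ‖((‖a‖ : ℂ) • x) n‖ := by
  rw [lp.coeFn_smul, Pi.smul_apply, smul_eq_mul, norm_mul, norm_mul, Complex.norm_real, norm_norm]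
  exact mul_le_mul_of_nonneg_right (lp.norm_apply_le_norm ENNReal.top_ne_zero a n) (norm_nonneg _)

theorem memℓp_mul (a : ℓ^∞(ℕ, ℂ)) (x : HilbertL2) : Memℓp (fun n => a n * x n) 2 :=
  (lp.memℓp ((‖a‖ : ℂ) • x)).mono' (norm_mul_apply_le a x)

/-- The diagonal operator `(x n) ↦ (a n * x n)` on `ℓ²(ℕ)` of a bounded sequence `a`. -/
def diagonalOp (a : ℓ^∞(ℕ, ℂ)) : BoundedOps :=
  LinearMap.mkContinuous
    { toFun := fun x => ⟨fun n => a n * x n, memℓp_mul a x⟩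
      map_add' := fun x y => by
        ext n
        exact mul_add (a n) (x n) (y n)
      map_smul' := fun c x => by
        ext n
        exact mul_left_comm (a n) c (x n) }
    ‖a‖ (fun x => by
      have h := lp.norm_mono (p := 2) two_ne_zero
        (x := (⟨fun n => a n * x n, memℓp_mul a x⟩ : HilbertL2)) (y := (‖a‖ : ℂ) • x)
        (norm_mul_apply_le a x)
      rw [norm_smul, Complex.norm_real, norm_norm] at h
      exact h)

theorem diagonalOp_apply (a : ℓ^∞(ℕ, ℂ)) (x : HilbertL2) (n : ℕ) :
    diagonalOp a x n = a n * x n := rfl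

/-- The action of `ℓ^∞(ℕ)` on `ℓ²(ℕ)` by diagonal operators, as a unital `*`-homomorphism. -/
def diagonalRep : ℓ^∞(ℕ, ℂ) →⋆ₐ[ℂ] BoundedOps where
  toFun := diagonalOp
  map_one' := by
    ext x n
    exact one_mul (x n)
  map_mul' a b := by
    ext x n
    exact mul_assoc (a n) (b n) (x n)
  map_zero' := by
    ext x n
    exact zero_mul (x n)
  map_add' a b := by
    ext x n
    exact add_mul (a n) (b n) (x n)
  commutes' c := by
    ext x n
    rfl
  map_star' a := by
    rw [ContinuousLinearMap.star_eq_adjoint, ContinuousLinearMap.eq_adjoint_iff]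
    intro x y
    rw [lp.inner_eq_tsum, lp.inner_eq_tsum]
    refine tsum_congr fun n => ?_
    rw [diagonalOp_apply, diagonalOp_apply, lp.star_apply]
    simp only [RCLike.inner_apply, map_mul, RCLike.star_def, RCLike.conj_conj]
    ring

/-- The diagonal algebra `D = ℓ^∞(ℕ)` acting on `ℓ²(ℕ)`: the unital `*`-subalgebra of `B(ℓ²(ℕ))`
of all diagonal operators, with the structure (norm, involution) inherited from `B(ℓ²(ℕ))`. -/
def diagonalAlgebra : StarSubalgebra ℂ BoundedOps := diagonalRep.range

end

/-!
The uniqueness of the extension rests on paving: for every `ε > 0` the index set of a self-adjoint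
contraction `T` of `ℓ²(ℕ)` with zero diagonal splits into finitely many classes such that the
compression of `T` to each class is at most `ε` (`exists_paving`). Given a pure state `φ` of the
diagonal algebra, which takes only the values `0` and `1` at projections, one of the class
projections `P` has `φ P = 1`. If `ψ` extends `φ`, then `ψ (1 - P) = 0`, and `T` is at most
`2 ε + (1 / ε + 1) (1 - P)`, so `ψ T ≤ 2 ε`. Applied to `T` and `-T` this shows that `ψ` annihilates
the operators with zero diagonal; hence `ψ` is `φ` composed with the conditional expectation onto the
diagonal algebra (`eq_comp_diagonalExpectation`). This composition is a state, which gives existence.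
Purity follows: if `ψ` is a proper convex combination of two states, their restrictions to the
diagonal algebra are both `φ`, so both are equal to `ψ`.

Paving is derived from the theorem of Marcus, Spielman and Srivastava
(`exists_coloring_re_dotProduct_le`): if `0 ≤ A ≤ 1` is a matrix with diagonal entries at most `α`,
its index set can be coloured with `r` colours such that every diagonal block of `A` is at most
`(1 + √(r α))² / r`. For a zero-diagonal contraction this is applied to the corners of `(1 + T) / 2`,
with `α = 1 / 2`; the number of colours depends only on `ε`, so an ultrafilter limit of the
colourings serves the whole operator.

For the finite theorem each colouring `c` is assigned the product of the characteristic polynomials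
of the blocks of `r A`. The average of these products over a random colouring with independent
colours is obtained by applying `∏ (1 - ∂ᵢ)` to a product of determinants `det (x + diag (tᵢ) A)` and
setting `t = 0` (`eval_zero_oneSubPDerivs_colorPoly`). Three facts finish the argument.

* The averages are real-rooted, since `1 - ∂ᵢ` preserves the absence of zeros in half-planes
  (`MvPolynomial.IsStable.oneSubPDerivs`, `splits_averagePoly_colorCharpoly`).
* Consequently some colouring does as well as the average: fixing the colours one after the other
  joins two averages by a segment of real-rooted polynomials, along which no root can cross a given
  bound (`eval_pos_of_segment`, `exists_pos_of_averagePoly_pos`).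
* The roots of the average for uniformly random colours are below `(1 + √(r α))²`
  (`averagePoly_uniform_pos`). This is the barrier argument: the functions `∂ⱼ log p` of a stable
  polynomial decrease and are convex in each coordinate above its zeros, so that `1 - ∂ᵢ` followed by
  a shift of the coordinate `i` does not increase them (`MvPolynomial.StableAbove.sub_pderiv`). The
  convexity is obtained from a partial fraction expansion of `∂ⱼ p / p` along a line, whose residues
  are nonnegative because that function maps the upper half-plane to the lower one
  (`exists_partial_fractions`).
-/

open Polynomial ComplexConjugate

/-! ### Univariate polynomials without zeros in a half-plane -/

lemma im_one_div_sub_neg {c : ℝ} {z r : ℂ} (hz : c < z.im) (hr : r.im ≤ c) :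
    (1 / (z - r)).im < 0 := by
  have h : 0 < (z - r).im := by rw [Complex.sub_im]; linarith
  have h0 : z - r ≠ 0 := fun h' => by rw [h'] at h; simp at h
  rw [one_div, Complex.inv_im]
  exact div_neg_of_neg_of_pos (by linarith) (Complex.normSq_pos.mpr h0)

/-- The logarithmic derivative of a polynomial without zeros in a half-plane `Im z > c` maps that
half-plane to the open lower half-plane, unless the polynomial is constant. -/
lemma im_logDeriv_neg_or_eq_zero {q : ℂ[X]} {c : ℝ} (hq : ∀ z : ℂ, c < z.im → q.eval z ≠ 0)
    {z : ℂ} (hz : c < z.im) :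
    (q.derivative.eval z / q.eval z).im < 0 ∨ q.derivative.eval z / q.eval z = 0 := by
  rw [(IsAlgClosed.splits q).eval_derivative_div_eval_of_ne_zero (hq z hz)]
  have hroots : ∀ r ∈ q.roots, r.im ≤ c := fun r hr => by
    by_contra! h
    exact hq r h (isRoot_of_mem_roots hr)
  generalize q.roots = R at hroots
  induction R using Multiset.induction with
  | empty => simp
  | cons r R ih =>
    left
    have h1 := im_one_div_sub_neg hz (hroots r (by simp))
    rw [Multiset.map_cons, Multiset.sum_cons, Complex.add_im]
    rcases ih (fun s hs => hroots s (Multiset.mem_cons_of_mem hs)) with h | h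
    · linarith
    · rw [h, Complex.zero_im]; linarith

lemma im_derivative_mul_conj_nonpos {q : ℂ[X]} {c : ℝ} (hq : ∀ z : ℂ, c < z.im → q.eval z ≠ 0)
    {z : ℂ} (hz : c < z.im) : (q.derivative.eval z * conj (q.eval z)).im ≤ 0 := by
  have h0 := hq z hz
  have : q.derivative.eval z * conj (q.eval z)
      = (q.derivative.eval z / q.eval z) * (Complex.normSq (q.eval z) : ℂ) := by
    rw [← Complex.mul_conj]
    field_simp
  rw [this, Complex.im_mul_ofReal]
  refine mul_nonpos_of_nonpos_of_nonneg ?_ (Complex.normSq_nonneg _)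
  rcases im_logDeriv_neg_or_eq_zero hq hz with h | h
  · exact h.le
  · rw [h, Complex.zero_im]

lemma eval_sub_derivative_ne_zero {q : ℂ[X]} {c : ℝ} (hq : ∀ z : ℂ, c < z.im → q.eval z ≠ 0)
    {z : ℂ} (hz : c < z.im) : q.eval z - q.derivative.eval z ≠ 0 := by
  have h0 := hq z hz
  intro h
  have h1 : q.derivative.eval z / q.eval z = 1 := by
    rw [← sub_eq_zero.mp h, div_self h0]
  rcases im_logDeriv_neg_or_eq_zero hq hz with h | h <;> simp [h1] at h

/-- A quantitative form of Hurwitz's theorem for polynomials of bounded degree: the inequality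
survives limits, so a limit of polynomials without zeros in the upper half-plane has no zeros there
unless it vanishes identically. -/
lemma norm_eval_add_le {q : ℂ[X]} (hq : ∀ z : ℂ, 0 < z.im → q.eval z ≠ 0) {d : ℕ}
    (hd : q.natDegree ≤ d) {z : ℂ} (hz : 0 < z.im) (u : ℂ) :
    ‖q.eval (z + u)‖ ≤ ‖q.eval z‖ * (1 + ‖u‖ / z.im) ^ d := by
  have hs := IsAlgClosed.splits q
  have hK : 1 ≤ 1 + ‖u‖ / z.im := by
    have : 0 ≤ ‖u‖ / z.im := by positivity
    linarith
  have hcard : q.roots.card ≤ d := (card_roots' q).trans hd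
  suffices h : ‖q.eval (z + u)‖ ≤ ‖q.eval z‖ * (1 + ‖u‖ / z.im) ^ q.roots.card from
    h.trans (mul_le_mul_of_nonneg_left (pow_le_pow_right₀ hK hcard) (norm_nonneg _))
  have hroots : ∀ r ∈ q.roots, r.im ≤ 0 := fun r hr => by
    by_contra! h
    exact hq r h (isRoot_of_mem_roots hr)
  rw [hs.eval_eq_prod_roots, hs.eval_eq_prod_roots, norm_mul, norm_mul, mul_assoc]
  refine mul_le_mul_of_nonneg_left ?_ (norm_nonneg _)
  generalize q.roots = R at hroots
  induction R using Multiset.induction with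
  | empty => simp
  | cons r R ih =>
    have ih := ih (fun s hs => hroots s (Multiset.mem_cons_of_mem hs))
    have hr := hroots r (by simp)
    rw [Multiset.map_cons, Multiset.prod_cons, Multiset.map_cons, Multiset.prod_cons, norm_mul,
      norm_mul, Multiset.card_cons, pow_succ]
    have him : z.im ≤ ‖z - r‖ := by
      have := Complex.abs_im_le_norm (z - r)
      rw [Complex.sub_im] at this
      linarith [le_abs_self (z.im - r.im)]
    have h1 : ‖z + u - r‖ ≤ ‖z - r‖ * (1 + ‖u‖ / z.im) := by
      have e : z + u - r = (z - r) + u := by ring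
      have h2 : ‖u‖ ≤ ‖z - r‖ * (‖u‖ / z.im) := by
        rw [mul_div_assoc', le_div_iff₀ hz, mul_comm]
        exact mul_le_mul_of_nonneg_right him (norm_nonneg _)
      rw [e]
      linarith [norm_add_le (z - r) u]
    calc _ ≤ (‖z - r‖ * (1 + ‖u‖ / z.im)) * (‖(R.map (z - ·)).prod‖ * (1 + ‖u‖ / z.im) ^ R.card) :=
          mul_le_mul h1 ih (norm_nonneg _) (by positivity)
      _ = _ := by ring

lemma eval_map_ofReal_conj (q : ℝ[X]) (z : ℂ) :
    (q.map (algebraMap ℝ ℂ)).eval (conj z) = conj ((q.map (algebraMap ℝ ℂ)).eval z) := by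
  rw [eval_map_algebraMap, eval_map_algebraMap, aeval_conj]

lemma eval_map_ofReal_ofReal (q : ℝ[X]) (x : ℝ) :
    (q.map (algebraMap ℝ ℂ)).eval (x : ℂ) = ((q.eval x : ℝ) : ℂ) := by
  rw [eval_map_algebraMap, ← Complex.coe_algebraMap, aeval_algebraMap_apply_eq_algebraMap_eval]

/-- A real polynomial without zeros in the upper half-plane is real-rooted. -/
lemma splits_of_eval_ne_zero_of_im_pos {q : ℝ[X]}
    (h : ∀ z : ℂ, 0 < z.im → (q.map (algebraMap ℝ ℂ)).eval z ≠ 0) : q.Splits := by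
  refine Splits.of_splits_map (algebraMap ℝ ℂ) (IsAlgClosed.splits _) fun z hz => ?_
  have hz0 : (q.map (algebraMap ℝ ℂ)).eval z = 0 := isRoot_of_mem_roots hz
  rcases lt_trichotomy z.im 0 with hi | hi | hi
  · refine absurd ?_ (h (conj z) (by simpa using hi))
    rw [eval_map_ofReal_conj, hz0, map_zero]
  · exact ⟨z.re, by apply Complex.ext <;> simp [hi]⟩
  · exact absurd hz0 (h z hi)

/-! ### Partial fractions of functions mapping the upper half-plane to the lower one -/

/-- If `s / q` maps the upper half-plane to the closed lower one, then its real poles are simple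
with positive residues: near a pole `r` of order `m` it behaves like a multiple of `(z - r)⁻ᵐ`,
whose argument covers too large an angle when `2 ≤ m`. -/
lemma pole_simple_of_im_nonpos {q s g : ℝ[X]} {r : ℝ} {m : ℕ} (hm : m ≠ 0)
    (hq : q = (X - C r) ^ m * g) (hg : g.eval r ≠ 0) (hs : s.eval r ≠ 0)
    (him : ∀ z : ℂ, 0 < z.im → ((s.map (algebraMap ℝ ℂ)).eval z *
      conj ((q.map (algebraMap ℝ ℂ)).eval z)).im ≤ 0) :
    m = 1 ∧ 0 < s.eval r * g.eval r := by
  -- substitute `z = r + ρ w` and let `ρ` tend to `0`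
  have key : ∀ w : ℂ, 0 < w.im → 0 ≤ (s.eval r * g.eval r) * (w ^ m).im := by
    intro w hw
    have h1 : ∀ ρ : ℝ, 0 < ρ → ((s.map (algebraMap ℝ ℂ)).eval (r + ρ * w) *
        conj ((g.map (algebraMap ℝ ℂ)).eval (r + ρ * w)) * conj w ^ m).im ≤ 0 := by
      intro ρ hρ
      have h := him (r + ρ * w) (by simpa using mul_pos hρ hw)
      have e : (q.map (algebraMap ℝ ℂ)).eval (r + ρ * w)
          = ((ρ ^ m : ℝ) : ℂ) * (w ^ m * (g.map (algebraMap ℝ ℂ)).eval (r + ρ * w)) := by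
        rw [hq]
        simp [mul_pow, mul_assoc]
      rw [e, map_mul, Complex.conj_ofReal, mul_left_comm, Complex.im_ofReal_mul] at h
      have h2 := nonpos_of_mul_nonpos_right h (pow_pos hρ m)
      rw [map_mul, map_pow] at h2
      rwa [mul_comm (conj w ^ m), ← mul_assoc] at h2
    have hc : Continuous fun ρ : ℝ => ((s.map (algebraMap ℝ ℂ)).eval (r + ρ * w) *
        conj ((g.map (algebraMap ℝ ℂ)).eval (r + ρ * w)) * conj w ^ m).im := by
      have h1 : Continuous fun ρ : ℝ => (r + ρ * w : ℂ) := by fun_prop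
      exact Complex.continuous_im.comp ((((Polynomial.continuous _).comp h1).mul
        (Complex.continuous_conj.comp ((Polynomial.continuous _).comp h1))).mul continuous_const)
    have h2 : ((s.map (algebraMap ℝ ℂ)).eval (r + (0 : ℝ) * w) *
        conj ((g.map (algebraMap ℝ ℂ)).eval (r + (0 : ℝ) * w)) * conj w ^ m).im ≤ 0 := by
      refine le_of_tendsto ((hc.tendsto 0).mono_left (nhdsWithin_le_nhds (s := Set.Ioi 0))) ?_
      filter_upwards [self_mem_nhdsWithin] with ρ hρ using h1 ρ hρ
    rw [Complex.ofReal_zero, zero_mul, add_zero, eval_map_ofReal_ofReal, eval_map_ofReal_ofReal,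
      Complex.conj_ofReal, ← Complex.ofReal_mul, Complex.im_ofReal_mul, ← map_pow,
      Complex.conj_im] at h2
    linarith
  have hne : s.eval r * g.eval r ≠ 0 := mul_ne_zero hs hg
  have hmpos : (0 : ℝ) < m := by exact_mod_cast Nat.pos_of_ne_zero hm
  have hexp : ∀ θ : ℝ, 0 < θ → θ < Real.pi →
      0 ≤ (s.eval r * g.eval r) * Real.sin (m * θ) := by
    intro θ h0 h1
    have h := key (Complex.exp (θ * Complex.I))
      (by rw [Complex.exp_ofReal_mul_I_im]; exact Real.sin_pos_of_pos_of_lt_pi h0 h1)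
    rw [← Complex.exp_nat_mul, ← mul_assoc] at h
    have : ((m : ℂ) * (θ : ℂ)) = ((m * θ : ℝ) : ℂ) := by push_cast; rfl
    rwa [this, Complex.exp_ofReal_mul_I_im] at h
  have hm1 : (1 : ℝ) ≤ m := by exact_mod_cast Nat.one_le_iff_ne_zero.mpr hm
  have hpos : 0 ≤ s.eval r * g.eval r := by
    have h := hexp (Real.pi / (2 * m)) (by positivity)
      (by rw [div_lt_iff₀ (by positivity)]; nlinarith [Real.pi_pos])
    have e : (m : ℝ) * (Real.pi / (2 * m)) = Real.pi / 2 := by field_simp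
    rwa [e, Real.sin_pi_div_two, mul_one] at h
  -- for `2 ≤ m` the angle `3 π / (2 m)` is less than `π`, and `sin (m θ)` is `-1` there
  refine ⟨?_, lt_of_le_of_ne hpos hne.symm⟩
  by_contra hm'
  have hm2 : (2 : ℝ) ≤ m := by exact_mod_cast (show 2 ≤ m by omega)
  have h := hexp (3 * Real.pi / (2 * m)) (by positivity)
    (by rw [div_lt_iff₀ (by positivity)]; nlinarith [Real.pi_pos])
  have e : (m : ℝ) * (3 * Real.pi / (2 * m)) = Real.pi / 2 + Real.pi := by field_simp; ring
  rw [e, Real.sin_add_pi, Real.sin_pi_div_two] at h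
  exact hne (le_antisymm (by linarith) hpos)

/-- A rational function bounded on a half-line has a numerator of degree at most that of its
denominator. -/
lemma degree_le_of_abs_div_le {q s : ℝ[X]} {a M : ℝ} (hq : q ≠ 0)
    (h : ∀ t, a ≤ t → |s.eval t / q.eval t| ≤ M) : s.degree ≤ q.degree := by
  by_contra! hlt
  have h1 := abs_div_tendsto_atTop_atTop_of_degree_gt s q hlt hq
  obtain ⟨t, ht, hM⟩ := ((Filter.eventually_ge_atTop a).and
    (h1.eventually (Filter.eventually_gt_atTop M))).exists
  exact absurd (h t ht) (not_le.mpr hM)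

/-- Partial fractions: a real rational function which maps the upper half-plane to the closed lower
one, and whose poles are real and to the left of `a`, is a sum of terms `w / (t - r)` with `0 ≤ w`
plus a constant, as soon as it is bounded on `[a, ∞)`. -/
lemma exists_partial_fractions {a M : ℝ} (n : ℕ) : ∀ q s : ℝ[X], q.natDegree = n → q.Splits →
    (∀ t, a ≤ t → q.eval t ≠ 0) →
    (∀ z : ℂ, 0 < z.im → ((s.map (algebraMap ℝ ℂ)).eval z *
      conj ((q.map (algebraMap ℝ ℂ)).eval z)).im ≤ 0) →
    (∀ t, a ≤ t → |s.eval t / q.eval t| ≤ M) →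
    ∃ (ι : Finset ℝ) (w : ℝ → ℝ) (κ : ℝ), (∀ r ∈ ι, 0 ≤ w r ∧ r < a) ∧
      ∀ t, q.eval t ≠ 0 → s.eval t / q.eval t = κ + ∑ r ∈ ι, w r * (t - r)⁻¹ := by
  induction n with
  | zero =>
    intro q s hn hq hqa him hbd
    have hq0 : q ≠ 0 := fun h => hqa a le_rfl (by rw [h, eval_zero])
    have hdeg := degree_le_of_abs_div_le hq0 hbd
    have hs : s.natDegree ≤ 0 := hn ▸ natDegree_le_natDegree hdeg
    refine ⟨∅, 0, s.coeff 0 / q.coeff 0, by simp, fun t _ => ?_⟩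
    rw [eq_C_of_natDegree_eq_zero hn, eq_C_of_natDegree_le_zero hs]
    simp
  | succ n ih =>
    intro q s hn hq hqa him hbd
    have hq0 : q ≠ 0 := fun h => hqa a le_rfl (by rw [h, eval_zero])
    -- a common zero of `q` and `s` cancels; otherwise all zeros of `q` are simple poles
    by_cases hcom : ∃ r, q.eval r = 0 ∧ s.eval r = 0
    · obtain ⟨r, hqr, hsr⟩ := hcom
      obtain ⟨q₁, rfl⟩ := dvd_iff_isRoot.mpr hqr
      obtain ⟨s₁, rfl⟩ := dvd_iff_isRoot.mpr hsr
      have hq₁ : q₁ ≠ 0 := right_ne_zero_of_mul hq0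
      have hev : ∀ t, ((X - C r) * q₁).eval t ≠ 0 → t - r ≠ 0 ∧ q₁.eval t ≠ 0 := fun t ht => by
        rw [eval_mul] at ht
        exact ⟨by simpa using left_ne_zero_of_mul ht, right_ne_zero_of_mul ht⟩
      have hdiv : ∀ t, ((X - C r) * q₁).eval t ≠ 0 →
          ((X - C r) * s₁).eval t / ((X - C r) * q₁).eval t = s₁.eval t / q₁.eval t :=
        fun t ht => by
          rw [eval_mul, eval_mul]
          exact mul_div_mul_left _ _ (by simpa using (hev t ht).1)
      obtain ⟨ι, w, κ, h1, h2⟩ := ih q₁ s₁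
        (by rw [natDegree_mul (X_sub_C_ne_zero r) hq₁, natDegree_X_sub_C] at hn; omega)
        (splits_X_sub_C_mul_iff.mp hq) (fun t ht => (hev t (hqa t ht)).2)
        (fun z hz => by
          have h := him z hz
          have hne : z - r ≠ 0 := fun h0 => by
            have := congrArg Complex.im h0
            simp at this
            linarith
          have e : (((X - C r) * s₁).map (algebraMap ℝ ℂ)).eval z *
              conj ((((X - C r) * q₁).map (algebraMap ℝ ℂ)).eval z)
              = (Complex.normSq (z - r) : ℂ) * ((s₁.map (algebraMap ℝ ℂ)).eval z *
                conj ((q₁.map (algebraMap ℝ ℂ)).eval z)) := by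
            rw [← Complex.mul_conj]
            simp only [Polynomial.map_mul, eval_mul, map_mul, Polynomial.map_sub, map_X, map_C,
              eval_sub, eval_X, eval_C, Complex.coe_algebraMap]
            ring
          rw [e, Complex.im_ofReal_mul] at h
          exact nonpos_of_mul_nonpos_right h (Complex.normSq_pos.mpr hne))
        (fun t ht => by rw [← hdiv t (hqa t ht)]; exact hbd t ht)
      exact ⟨ι, w, κ, h1, fun t ht => by rw [hdiv t ht]; exact h2 t (hev t ht).2⟩
    · push Not at hcom
      have hmult : ∀ r, q.eval r = 0 → q.rootMultiplicity r = 1 ∧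
          0 < s.eval r * q.derivative.eval r := by
        intro r hr
        obtain ⟨g, hg, hnd⟩ := exists_eq_pow_rootMultiplicity_mul_and_not_dvd q hq0 r
        have hgr : g.eval r ≠ 0 := fun h => hnd (dvd_iff_isRoot.mpr h)
        have h := pole_simple_of_im_nonpos ((rootMultiplicity_pos hq0).mpr hr).ne' hg hgr
          (hcom r hr) him
        refine ⟨h.1, ?_⟩
        rw [h.1, pow_one] at hg
        rw [hg]
        simpa using h.2
      have hnodup : q.roots.Nodup := Multiset.nodup_iff_count_le_one.mpr fun r => by
        rw [count_roots]
        by_cases hr : q.eval r = 0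
        · exact (hmult r hr).1.le
        · rw [rootMultiplicity_eq_zero hr]; exact zero_le_one
      have hqn : q = C q.leadingCoeff * Lagrange.nodal q.roots.toFinset id := by
        conv_lhs => rw [hq.eq_prod_roots]
        rw [Lagrange.nodal, Finset.prod, Multiset.toFinset_val, hnodup.dedup]
        rfl
      have hlc : q.leadingCoeff ≠ 0 := leadingCoeff_ne_zero.mpr hq0
      have hmem : ∀ r, r ∈ q.roots.toFinset ↔ q.eval r = 0 := fun r => by
        rw [Multiset.mem_toFinset, mem_roots hq0, IsRoot.def]
      have hcard : q.degree = (q.roots.toFinset.card : WithBot ℕ) := by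
        conv_lhs => rw [hqn]
        rw [degree_C_mul hlc, Lagrange.degree_nodal]
      have hquo : s / q = C ((s / q).coeff 0) := by
        apply eq_C_of_degree_le_zero
        by_contra! hpos
        have hle := degree_le_of_abs_div_le hq0 hbd
        have hs : q.degree ≤ s.degree := by
          by_contra! hlt
          rw [(Polynomial.div_eq_zero_iff hq0).mpr hlt] at hpos
          simp at hpos
        have h := degree_add_div hq0 hs
        rw [← h, degree_eq_natDegree hq0,
          degree_eq_natDegree (fun h0 => by simp [h0] at hpos : s / q ≠ 0)] at hle
        rw [degree_eq_natDegree (fun h0 => by simp [h0] at hpos : s / q ≠ 0)] at hpos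
        norm_cast at hle hpos
        omega
      have hsd : s = q * C ((s / q).coeff 0) + s % q := by
        rw [← hquo]; exact (EuclideanDomain.div_add_mod s q).symm
      -- the remainder of `s` modulo `q` is the Lagrange interpolant of `s` at the zeros of `q`
      have hint := Lagrange.eq_interpolate (f := s % q) (s := q.roots.toFinset)
        (Function.injective_id.injOn) (hcard ▸ EuclideanDomain.mod_lt s hq0)
      refine ⟨q.roots.toFinset,
        fun r => Lagrange.nodalWeight q.roots.toFinset id r * s.eval r / q.leadingCoeff,
        (s / q).coeff 0, fun r hr => ⟨?_, ?_⟩, fun t ht => ?_⟩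
      · have h := (hmult r ((hmem r).mp hr)).2
        have hd : q.derivative.eval r
            = q.leadingCoeff * (Lagrange.nodalWeight q.roots.toFinset id r)⁻¹ := by
          conv_lhs => rw [hqn]
          rw [Lagrange.nodalWeight_eq_eval_derivative_nodal hr, inv_inv, derivative_C_mul, eval_mul,
            eval_C]
          rfl
        have hw := Lagrange.nodalWeight_ne_zero (s := q.roots.toFinset) (v := (id : ℝ → ℝ))
          Function.injective_id.injOn hr
        rw [hd] at h
        have e : Lagrange.nodalWeight q.roots.toFinset id r * s.eval r / q.leadingCoeff
            = (s.eval r * (q.leadingCoeff * (Lagrange.nodalWeight q.roots.toFinset id r)⁻¹)) *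
              (Lagrange.nodalWeight q.roots.toFinset id r / q.leadingCoeff) ^ 2 := by
          field_simp
        simp only [e]
        positivity
      · by_contra! h
        exact hqa r h ((hmem r).mp hr)
      · have hne : ∀ r ∈ q.roots.toFinset, t ≠ id r := fun r hr h => ht (by
          rw [h]; exact (hmem r).mp hr)
        have h1 : (s % q).eval t = (Lagrange.nodal q.roots.toFinset id).eval t *
            ∑ r ∈ q.roots.toFinset, Lagrange.nodalWeight q.roots.toFinset id r * (t - id r)⁻¹ *
              (s % q).eval (id r) := by
          conv_lhs => rw [hint]
          exact Lagrange.eval_interpolate_not_at_node _ hne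
        have h2 : q.eval t = q.leadingCoeff * (Lagrange.nodal q.roots.toFinset id).eval t := by
          conv_lhs => rw [hqn]
          rw [eval_mul, eval_C]
        have h3 : ∀ r ∈ q.roots.toFinset, (s % q).eval r = s.eval r := fun r hr => by
          conv_rhs => rw [hsd]
          rw [eval_add, eval_mul, (hmem r).mp hr, zero_mul, zero_add]
        have h4 : s.eval t = q.eval t * (s / q).coeff 0 + (s % q).eval t := by
          conv_lhs => rw [hsd]
          simp
        have hn0 : (Lagrange.nodal q.roots.toFinset id).eval t ≠ 0 :=
          right_ne_zero_of_mul (h2 ▸ ht)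
        rw [h4, add_div, mul_div_cancel_left₀ _ ht, h1, h2, mul_comm, mul_div_mul_right _ _ hn0,
          Finset.sum_div]
        congr 1
        refine Finset.sum_congr rfl fun r hr => ?_
        rw [id, h3 r hr]
        ring

/-! ### Convexity to the right of the poles, and segments of real-rooted polynomials -/

lemma hasDerivAt_eval_div_eval {q s : ℝ[X]} {t : ℝ} (hq : q.eval t ≠ 0) :
    HasDerivAt (fun t => s.eval t / q.eval t)
      ((s.derivative.eval t * q.eval t - s.eval t * q.derivative.eval t) / q.eval t ^ 2) t :=
  (s.hasDerivAt t).div (q.hasDerivAt t) hq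

/-- The derivative of `s / q` on the real line is nonpositive: the function `Im (s q̄)` vanishes there
and is nonpositive above it. -/
lemma wronskian_nonpos_of_im_nonpos {q s : ℝ[X]}
    (him : ∀ z : ℂ, 0 < z.im → ((s.map (algebraMap ℝ ℂ)).eval z *
      conj ((q.map (algebraMap ℝ ℂ)).eval z)).im ≤ 0) (t : ℝ) :
    s.derivative.eval t * q.eval t - s.eval t * q.derivative.eval t ≤ 0 := by
  have hline : HasDerivAt (fun η : ℝ => (t + η * Complex.I : ℂ)) Complex.I 0 := by
    have := ((Complex.ofRealCLM.hasDerivAt (x := (0 : ℝ))).mul_const Complex.I).const_add (t : ℂ)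
    simpa using this
  have hd : ∀ p : ℝ[X], HasDerivAt (fun η : ℝ => (p.map (algebraMap ℝ ℂ)).eval
      (t + η * Complex.I : ℂ)) ((p.derivative.eval t : ℝ) * Complex.I) 0 := fun p => by
    have h1 := (p.map (algebraMap ℝ ℂ)).hasDerivAt ((t : ℂ) + ((0 : ℝ) : ℂ) * Complex.I)
    have h2 := HasDerivAt.comp (0 : ℝ) h1 hline
    rw [derivative_map] at h2
    simp only [Complex.ofReal_zero, zero_mul, add_zero, eval_map_ofReal_ofReal] at h2
    exact h2
  have hD := (hd s).mul (Complex.conjCLE.toContinuousLinearMap.hasFDerivAt.comp_hasDerivAt (0 : ℝ)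
    (hd q))
  have hI := Complex.imCLM.hasFDerivAt.comp_hasDerivAt (0 : ℝ) hD
  have hval := hI.tendsto_slope_zero_right
  refine le_of_tendsto_of_tendsto hval tendsto_const_nhds ?_ |>.trans_eq' ?_
  · filter_upwards [self_mem_nhdsWithin] with η hη
    have h := him (t + η * Complex.I) (by simpa using hη)
    have h0 : ((s.map (algebraMap ℝ ℂ)).eval (t : ℂ) *
        conj ((q.map (algebraMap ℝ ℂ)).eval (t : ℂ))).im = 0 := by
      rw [eval_map_ofReal_ofReal, eval_map_ofReal_ofReal, Complex.conj_ofReal,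
        ← Complex.ofReal_mul, Complex.ofReal_im]
    simp only [Function.comp_apply, zero_add, Complex.ofReal_zero, zero_mul, add_zero, smul_eq_mul,
      Pi.mul_apply, ContinuousLinearEquiv.coe_coe, Complex.conjCLE_apply, Complex.imCLM_apply]
    rw [h0, sub_zero]
    exact mul_nonpos_of_nonneg_of_nonpos (inv_nonneg.mpr (le_of_lt hη)) h
  · have hre : ∀ p : ℝ[X], ((aeval (t : ℂ)) p).re = p.eval t := fun p => by
      rw [← eval_map_algebraMap, eval_map_ofReal_ofReal, Complex.ofReal_re]
    simp [hre, sub_eq_add_neg]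

/-- Monotonicity and convexity of `s / q` on a half-line to the right of all its poles. Convexity is
stated as the tangent inequality at `u`, and is checked term by term in the partial fractions. -/
lemma antitone_and_tangent_le {q s : ℝ[X]} {a : ℝ} (hq : q.Splits)
    (hqa : ∀ t, a ≤ t → 0 < q.eval t) (hsa : ∀ t, a ≤ t → 0 ≤ s.eval t)
    (him : ∀ z : ℂ, 0 < z.im → ((s.map (algebraMap ℝ ℂ)).eval z *
      conj ((q.map (algebraMap ℝ ℂ)).eval z)).im ≤ 0) :
    AntitoneOn (fun t => s.eval t / q.eval t) (Set.Ici a) ∧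
    ∀ t u, a ≤ t → t ≤ u → (u - t) *
      ((s.eval u * q.derivative.eval u - s.derivative.eval u * q.eval u) / q.eval u ^ 2) ≤
      s.eval t / q.eval t - s.eval u / q.eval u := by
  have hanti : AntitoneOn (fun t => s.eval t / q.eval t) (Set.Ici a) := by
    refine antitoneOn_of_deriv_nonpos (convex_Ici a) (fun t ht =>
      (hasDerivAt_eval_div_eval (hqa t ht).ne').continuousAt.continuousWithinAt)
      (fun t ht => (hasDerivAt_eval_div_eval
        (hqa t (interior_subset ht)).ne').differentiableAt.differentiableWithinAt) fun t ht => ?_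
    rw [(hasDerivAt_eval_div_eval (hqa t (interior_subset ht)).ne').deriv]
    exact div_nonpos_of_nonpos_of_nonneg (wronskian_nonpos_of_im_nonpos him t) (sq_nonneg _)
  refine ⟨hanti, fun t u hat htu => ?_⟩
  obtain ⟨ι, w, κ, hw, hpf⟩ := exists_partial_fractions (a := a) (M := s.eval a / q.eval a)
    q.natDegree q s rfl hq (fun t ht => (hqa t ht).ne') him fun t ht => by
      rw [abs_of_nonneg (div_nonneg (hsa t ht) (hqa t ht).le)]
      exact hanti Set.self_mem_Ici ht ht
  have hau := hat.trans htu
  have hd : HasDerivAt (fun t => κ + ∑ r ∈ ι, w r * (t - r)⁻¹)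
      (∑ r ∈ ι, w r * (-1 / (u - r) ^ 2)) u := by
    refine (HasDerivAt.fun_sum fun r hr => ?_).const_add κ
    exact (((hasDerivAt_id u).sub_const r).inv
      (by have := (hw r hr).2; simp only [id]; exact (by linarith : 0 < u - r).ne')).const_mul (w r)
  have hev : (fun t => s.eval t / q.eval t) =ᶠ[nhds u] fun t => κ + ∑ r ∈ ι, w r * (t - r)⁻¹ := by
    filter_upwards [q.continuous.continuousAt.eventually_ne (hqa u hau).ne'] with x hx
    exact hpf x hx
  have hder := (hasDerivAt_eval_div_eval (s := s) (hqa u hau).ne').unique (hd.congr_of_eventuallyEq hev)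
  have hneg : (s.eval u * q.derivative.eval u - s.derivative.eval u * q.eval u) / q.eval u ^ 2
      = ∑ r ∈ ι, w r * (1 / (u - r) ^ 2) := by
    rw [← neg_sub, neg_div, hder, ← Finset.sum_neg_distrib]
    exact Finset.sum_congr rfl fun r _ => by ring
  rw [hneg, hpf t (hqa t hat).ne', hpf u (hqa u hau).ne', Finset.mul_sum, add_sub_add_left_eq_sub,
    ← Finset.sum_sub_distrib]
  refine Finset.sum_le_sum fun r hr => ?_
  obtain ⟨h0, h1⟩ := hw r hr
  have ht : 0 < t - r := by linarith
  have hu : 0 < u - r := by linarith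
  have : (u - t) * (1 / (u - r) ^ 2) ≤ (t - r)⁻¹ - (u - r)⁻¹ := by
    rw [inv_sub_inv ht.ne' hu.ne', mul_one_div, div_le_div_iff₀ (by positivity) (by positivity)]
    have : (u - r - (t - r)) = u - t := by ring
    rw [this]
    refine mul_le_mul_of_nonneg_left ?_ (by linarith)
    nlinarith
  calc (u - t) * (w r * (1 / (u - r) ^ 2)) = w r * ((u - t) * (1 / (u - r) ^ 2)) := by ring
    _ ≤ w r * ((t - r)⁻¹ - (u - r)⁻¹) := mul_le_mul_of_nonneg_left this h0
    _ = _ := by ring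

lemma coeff_prod_X_add_C_pos (R : Multiset ℝ) (hR : ∀ c ∈ R, 0 < c) (m : ℕ) (hm : m ≤ R.card) :
    0 < ((R.map fun c => X + C c).prod).coeff m := by
  induction R using Multiset.induction generalizing m with
  | empty =>
    obtain rfl : m = 0 := by simpa using hm
    simp
  | cons c R ih =>
    have ih := fun m => ih (fun c hc => hR c (Multiset.mem_cons_of_mem hc)) m
    have hc := hR c (by simp)
    have hdeg : ((R.map fun c => X + C c).prod).natDegree = R.card := by
      rw [natDegree_multiset_prod_of_monic _ fun f hf => by
        obtain ⟨c, -, rfl⟩ := Multiset.mem_map.mp hf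
        exact monic_X_add_C c]
      simp
    rw [Multiset.map_cons, Multiset.prod_cons, add_mul, coeff_add, coeff_C_mul]
    rw [Multiset.card_cons] at hm
    rcases m with _ | m
    · rw [coeff_X_mul_zero, zero_add]
      exact mul_pos hc (ih 0 (Nat.zero_le _))
    · rw [Polynomial.coeff_X_mul]
      have h1 := ih m (by omega)
      rcases Nat.lt_or_ge R.card (m + 1) with h | h
      · rw [coeff_eq_zero_of_natDegree_lt (n := m + 1) (hdeg.trans_lt h), mul_zero, add_zero]
        exact h1
      · exact add_pos h1 (mul_pos hc (ih _ h))

/-- The Taylor coefficients of a monic real-rooted polynomial are positive to the right of its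
roots. -/
lemma coeff_taylor_pos {f : ℝ[X]} (hf : f.Splits) (hm : f.Monic) {R : ℝ}
    (hR : ∀ x, R ≤ x → f.eval x ≠ 0) {m : ℕ} (hmn : m ≤ f.natDegree) : 0 < (taylor R f).coeff m := by
  have e : taylor R f = ((f.roots.map fun r => R - r).map fun c => X + C c).prod := by
    conv_lhs => rw [hf.eq_prod_roots_of_monic hm]
    rw [← taylorAlgHom_apply, map_multiset_prod, Multiset.map_map, Multiset.map_map]
    congr 1
    refine Multiset.map_congr rfl fun r _ => ?_
    simp [taylorAlgHom_apply, taylor_X, taylor_C, add_sub_assoc]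
  rw [e]
  refine coeff_prod_X_add_C_pos _ (fun c hc => ?_) m ?_
  · obtain ⟨r, hr, rfl⟩ := Multiset.mem_map.mp hc
    by_contra! h
    exact hR r (by linarith) (isRoot_of_mem_roots hr)
  · rwa [Multiset.card_map, ← hf.natDegree_eq_card_roots]

lemma eval_pos_of_coeff_taylor_nonneg {f : ℝ[X]} {R : ℝ} (h : ∀ m, 0 ≤ (taylor R f).coeff m)
    (h0 : 0 < f.eval R) {x : ℝ} (hx : R ≤ x) : 0 < f.eval x := by
  have e : f.eval x = (taylor R f).eval (x - R) := by rw [taylor_eval, sub_add_cancel]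
  rw [e, eval_eq_sum_range, Finset.sum_range_succ']
  refine add_pos_of_nonneg_of_pos (Finset.sum_nonneg fun i _ => mul_nonneg (h _)
    (pow_nonneg (by linarith) _)) ?_
  simpa using h0

/-- Real-rootedness along a segment of monic polynomials that stay positive at `R` prevents roots
from crossing `R`: having all roots to the left of `R` amounts to nonnegativity of the Taylor
coefficients at `R`, which is both an open and a closed condition on the segment. -/
lemma eval_pos_of_segment {f g : ℝ[X]} {n : ℕ} {R : ℝ} (hf : f.Monic) (hg : g.Monic)
    (hfn : f.natDegree = n) (hgn : g.natDegree = n)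
    (hs : ∀ t ∈ Set.Icc (0 : ℝ) 1, (C (1 - t) * f + C t * g).Splits)
    (hfR : ∀ x, R ≤ x → 0 < f.eval x) (hgR : 0 < g.eval R) {x : ℝ} (hx : R ≤ x) :
    0 < g.eval x := by
  set F : ℝ → ℝ[X] := fun t => C (1 - t) * f + C t * g with hF
  have hcoe : ∀ m, Continuous fun t : Set.Icc (0 : ℝ) 1 => (taylor R (F t)).coeff m := fun m => by
    have : ∀ t, (taylor R (F t)).coeff m
        = (1 - t) * (taylor R f).coeff m + t * (taylor R g).coeff m := fun t => by
      simp only [hF, map_add, taylor_mul, taylor_C, coeff_add, coeff_C_mul]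
    simp only [this]
    fun_prop
  have hlead : ∀ t, (F t).coeff n = 1 := fun t => by
    simp only [hF, coeff_add, coeff_C_mul]
    rw [← hfn, hf.coeff_natDegree, hfn, ← hgn, hg.coeff_natDegree]
    ring
  have hle : ∀ t, (F t).natDegree ≤ n := fun t =>
    (natDegree_add_le _ _).trans (max_le ((natDegree_C_mul_le _ _).trans hfn.le)
      ((natDegree_C_mul_le _ _).trans hgn.le))
  have hmon : ∀ t, (F t).Monic := fun t => monic_of_natDegree_le_of_coeff_eq_one n (hle t) (hlead t)
  have hdeg : ∀ t, (F t).natDegree = n := fun t =>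
    le_antisymm (hle t) (le_natDegree_of_ne_zero (by rw [hlead]; exact one_ne_zero))
  have hFR : ∀ t ∈ Set.Icc (0 : ℝ) 1, 0 < (F t).eval R := fun t ht => by
    simp only [hF, eval_add, eval_mul, eval_C]
    have h1 := hfR R le_rfl
    rcases ht.2.lt_or_eq with h | h
    · exact add_pos_of_pos_of_nonneg (mul_pos (by linarith) h1) (mul_nonneg ht.1 hgR.le)
    · rw [h]; simpa using hgR
  have hiff : ∀ t : Set.Icc (0 : ℝ) 1, (∀ m, 0 ≤ (taylor R (F t)).coeff m) ↔
      ∀ m ∈ Finset.range (n + 1), 0 < (taylor R (F t)).coeff m := fun t => by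
    refine ⟨fun h m hm => ?_, fun h m => ?_⟩
    · exact coeff_taylor_pos (hs t t.2) (hmon t)
        (fun x hx => (eval_pos_of_coeff_taylor_nonneg h (hFR t t.2) hx).ne')
        (by rw [hdeg]; exact Finset.mem_range_succ_iff.mp hm)
    · rcases Nat.lt_or_ge n m with hm | hm
      · rw [coeff_eq_zero_of_natDegree_lt (by rw [natDegree_taylor, hdeg]; exact hm)]
      · exact (h m (Finset.mem_range_succ_iff.mpr hm)).le
  have hclopen : IsClopen {t : Set.Icc (0 : ℝ) 1 | ∀ m, 0 ≤ (taylor R (F t)).coeff m} := by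
    constructor
    · simp only [Set.ofPred_forall]
      exact isClosed_iInter fun m => isClosed_le continuous_const (hcoe m)
    · simp only [hiff]
      have : {t : Set.Icc (0 : ℝ) 1 | ∀ m ∈ Finset.range (n + 1), 0 < (taylor R (F t)).coeff m}
          = ⋂ m ∈ Finset.range (n + 1), {t : Set.Icc (0 : ℝ) 1 | 0 < (taylor R (F t)).coeff m} := by
        ext t; simp
      rw [this]
      exact isOpen_biInter_finset fun m _ => isOpen_lt continuous_const (hcoe m)
  have h0 : F 0 = f := by simp [hF]
  have h1 : F 1 = g := by simp [hF]
  have huniv := hclopen.eq_univ ⟨⟨0, by simp⟩, (hiff _).mpr fun m hm => coeff_taylor_pos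
    (f := F 0) (hs 0 (by simp)) (hmon 0) (fun x hx => h0 ▸ (hfR x hx).ne')
    (by rw [hdeg]; exact Finset.mem_range_succ_iff.mp hm)⟩
  have hmem : (⟨1, by simp⟩ : Set.Icc (0 : ℝ) 1) ∈
      {t : Set.Icc (0 : ℝ) 1 | ∀ m, 0 ≤ (taylor R (F t)).coeff m} := huniv ▸ Set.mem_univ _
  simp only [Set.mem_ofPred_eq, h1] at hmem
  exact eval_pos_of_coeff_taylor_nonneg hmem hgR hx

/-! ### Stable multivariate polynomials and the barrier step -/

section Line
variable {σ R S : Type*} [DecidableEq σ] [CommRing R] [CommRing S]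

/-- The univariate polynomial `t ↦ p (z₁, …, t, …, zₙ)` with `t` in place of the coordinate `i`. -/
noncomputable def MvPolynomial.line (p : MvPolynomial σ R) (z : σ → R) (i : σ) : R[X] :=
  MvPolynomial.aeval (Function.update (fun k => Polynomial.C (z k)) i Polynomial.X) p

lemma MvPolynomial.eval_line (p : MvPolynomial σ R) (z : σ → R) (i : σ) (t : R) :
    (p.line z i).eval t = MvPolynomial.eval (Function.update z i t) p := by
  rw [MvPolynomial.line, ← Polynomial.coe_evalRingHom, MvPolynomial.aeval_def,
    MvPolynomial.hom_eval₂, ← MvPolynomial.eval₂_id (g := Function.update z i t)]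
  congr 1
  · ext r; simp
  · funext k
    rcases eq_or_ne k i with rfl | h
    · simp
    · simp [h]

lemma MvPolynomial.derivative_line (p : MvPolynomial σ R) (z : σ → R) (i : σ) :
    derivative (p.line z i) = (MvPolynomial.pderiv i p).line z i := by
  unfold MvPolynomial.line
  induction p using MvPolynomial.induction_on with
  | C a => simp
  | add p q hp hq => simp only [map_add, hp, hq]
  | mul_X p k hp =>
    rw [map_mul, derivative_mul, hp, MvPolynomial.aeval_X, Derivation.leibniz, map_add, smul_eq_mul,
      smul_eq_mul, map_mul, map_mul, MvPolynomial.aeval_X]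
    rcases eq_or_ne k i with rfl | h
    · simp; ring
    · simp [h]; ring

lemma MvPolynomial.map_line (f : R →+* S) (p : MvPolynomial σ R) (z : σ → R) (i : σ) :
    (p.line z i).map f = (MvPolynomial.map f p).line (fun k => f (z k)) i := by
  unfold MvPolynomial.line
  induction p using MvPolynomial.induction_on with
  | C a => simp
  | add p q hp hq => simp only [map_add, Polynomial.map_add, hp, hq]
  | mul_X p k hp =>
    rw [map_mul, Polynomial.map_mul, hp, map_mul, map_mul, MvPolynomial.map_X, MvPolynomial.aeval_X,
      MvPolynomial.aeval_X]
    rcases eq_or_ne k i with rfl | h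
    · simp
    · simp [h]

lemma MvPolynomial.exists_natDegree_line_le (p : MvPolynomial σ R) :
    ∃ d, ∀ z i, (p.line z i).natDegree ≤ d := by
  unfold MvPolynomial.line
  induction p using MvPolynomial.induction_on with
  | C a => exact ⟨0, fun z i => by simp⟩
  | add p q hp hq =>
    obtain ⟨d, hd⟩ := hp
    obtain ⟨e, he⟩ := hq
    exact ⟨max d e, fun z i => by
      rw [map_add]
      exact (natDegree_add_le _ _).trans (max_le_max (hd z i) (he z i))⟩
  | mul_X p k hp =>
    obtain ⟨d, hd⟩ := hp
    refine ⟨d + 1, fun z i => ?_⟩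
    rw [map_mul, MvPolynomial.aeval_X]
    refine natDegree_mul_le.trans (Nat.add_le_add (hd z i) ?_)
    rcases eq_or_ne k i with rfl | h
    · simpa using natDegree_X_le
    · simp [h]

lemma MvPolynomial.pderiv_comm (i j : σ) (p : MvPolynomial σ R) :
    MvPolynomial.pderiv i (MvPolynomial.pderiv j p)
      = MvPolynomial.pderiv j (MvPolynomial.pderiv i p) := by
  have h : ⁅(MvPolynomial.pderiv i : Derivation R (MvPolynomial σ R) _),
      MvPolynomial.pderiv j⁆ = 0 := MvPolynomial.derivation_ext fun k => by
    rw [Derivation.commutator_apply]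
    simp [MvPolynomial.pderiv_X, Pi.single_apply, apply_ite]
  have := congrArg (fun D => D p) h
  simpa [Derivation.commutator_apply, sub_eq_zero] using this

end Line

section Stable
variable {σ : Type*} [DecidableEq σ]

/-- `p` has no zero with all coordinates in the half-plane `Im > c`. -/
def MvPolynomial.IsStable (p : MvPolynomial σ ℂ) (c : ℝ) : Prop :=
  ∀ z : σ → ℂ, (∀ j, c < (z j).im) → MvPolynomial.eval z p ≠ 0

lemma MvPolynomial.IsStable.line {p : MvPolynomial σ ℂ} {c : ℝ} (hp : p.IsStable c) {z : σ → ℂ}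
    (hz : ∀ j, c < (z j).im) (i : σ) (t : ℂ) (ht : c < t.im) : (p.line z i).eval t ≠ 0 := by
  rw [MvPolynomial.eval_line]
  refine hp _ fun j => ?_
  rcases eq_or_ne j i with rfl | h
  · simpa using ht
  · simpa [h] using hz j

lemma MvPolynomial.IsStable.sub_pderiv {p : MvPolynomial σ ℂ} {c : ℝ} (hp : p.IsStable c) (i : σ) :
    (p - MvPolynomial.pderiv i p).IsStable c := fun z hz => by
  have h := eval_sub_derivative_ne_zero (hp.line hz i) (hz i)
  rwa [MvPolynomial.derivative_line, MvPolynomial.eval_line, MvPolynomial.eval_line,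
    Function.update_eq_self, ← map_sub] at h

lemma MvPolynomial.IsStable.im_pderiv_mul_conj_nonpos {p : MvPolynomial σ ℂ} {c : ℝ}
    (hp : p.IsStable c) {z : σ → ℂ} (hz : ∀ j, c < (z j).im) (j : σ) :
    (MvPolynomial.eval z (MvPolynomial.pderiv j p) * conj (MvPolynomial.eval z p)).im ≤ 0 := by
  have h := _root_.im_derivative_mul_conj_nonpos (hp.line hz j) (hz j)
  rwa [MvPolynomial.derivative_line, MvPolynomial.eval_line, MvPolynomial.eval_line,
    Function.update_eq_self] at h

/-- A stable polynomial which does not vanish at a real point `b` remains nonzero when one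
coordinate of `b` is moved into the upper half-plane. -/
lemma MvPolynomial.IsStable.eval_update_ne_zero {p : MvPolynomial σ ℂ} (hp : p.IsStable 0)
    {b : σ → ℝ} (hb : MvPolynomial.eval (fun k => (b k : ℂ)) p ≠ 0) (i : σ) {t : ℂ}
    (ht : 0 < t.im) : MvPolynomial.eval (Function.update (fun k => (b k : ℂ)) i t) p ≠ 0 := by
  obtain ⟨d, hd⟩ := p.exists_natDegree_line_le
  set B : σ → ℂ := fun k => (b k : ℂ) with hB
  set K : ℝ := (1 + ‖(b i : ℂ) - t‖ / t.im) ^ d with hK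
  have hup : ∀ (ε : ℝ) (s : ℂ), Function.update (fun k => B k + ε * Complex.I) i (s + ε * Complex.I)
      = fun k => Function.update B i s k + ε * Complex.I := fun ε s => by
    funext k
    rcases eq_or_ne k i with rfl | h
    · simp
    · simp [h]
  have h1 : ∀ ε : ℝ, 0 < ε → ‖MvPolynomial.eval (fun k => B k + ε * Complex.I) p‖ ≤
      ‖MvPolynomial.eval (fun k => Function.update B i t k + ε * Complex.I) p‖ * K := fun ε hε => by
    have hz : ∀ j, 0 < (B j + ε * Complex.I).im := fun j => by simpa [hB] using hε
    have h := norm_eval_add_le (hp.line hz i) (hd _ i) (z := t + ε * Complex.I)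
      (by simpa using add_pos ht hε) ((b i : ℂ) - t)
    have e : t + ε * Complex.I + ((b i : ℂ) - t) = B i + ε * Complex.I := by simp [hB]; ring
    rw [e, MvPolynomial.eval_line, MvPolynomial.eval_line, hup, hup, Function.update_eq_self] at h
    refine h.trans (mul_le_mul_of_nonneg_left ?_ (norm_nonneg _))
    have him : (t + ε * Complex.I).im = t.im + ε := by simp
    rw [him]
    have hpos : 0 < t.im + ε := add_pos ht hε
    exact pow_le_pow_left₀ (by positivity) (add_le_add_right (div_le_div_of_nonneg_left
      (norm_nonneg _) ht (le_add_of_nonneg_right hε.le)) 1) d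
  have hc : ∀ w : σ → ℂ, Filter.Tendsto (fun ε : ℝ => ‖MvPolynomial.eval
      (fun k => w k + ε * Complex.I) p‖) (nhdsWithin 0 (Set.Ioi 0)) (nhds ‖MvPolynomial.eval w p‖) :=
    fun w => by
      have h : Continuous fun ε : ℝ => ‖MvPolynomial.eval (fun k => w k + ε * Complex.I) p‖ :=
        ((MvPolynomial.continuous_eval p).comp (by fun_prop)).norm
      have h2 := (h.tendsto 0).mono_left (nhdsWithin_le_nhds (s := Set.Ioi 0))
      simpa using h2
  intro h0
  have h2 := le_of_tendsto_of_tendsto (hc B) ((hc (Function.update B i t)).mul_const K)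
    (by filter_upwards [self_mem_nhdsWithin] with ε hε using h1 ε hε)
  rw [h0, norm_zero, zero_mul] at h2
  exact hb (norm_le_zero_iff.mp h2)

/-- A real polynomial is stable above `a` if it is stable and positive on the orthant `a + ℝ₊ⁿ`. -/
structure MvPolynomial.StableAbove (p : MvPolynomial σ ℝ) (a : σ → ℝ) : Prop where
  isStable : (MvPolynomial.map (algebraMap ℝ ℂ) p).IsStable 0
  pos : ∀ b, a ≤ b → 0 < MvPolynomial.eval b p

/-- The barrier function `∂ⱼ log p`. -/
noncomputable def MvPolynomial.barrier (j : σ) (p : MvPolynomial σ ℝ) (b : σ → ℝ) : ℝ :=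
  MvPolynomial.eval b (MvPolynomial.pderiv j p) / MvPolynomial.eval b p

lemma le_update_of_le {a b : σ → ℝ} (hab : a ≤ b) {i : σ} {t : ℝ} (ht : a i ≤ t) :
    a ≤ Function.update b i t := le_update_iff.mpr ⟨ht, fun j _ => hab j⟩

namespace MvPolynomial.StableAbove
variable {p : MvPolynomial σ ℝ} {a b : σ → ℝ}

lemma splits_line (hp : p.StableAbove a) (hab : a ≤ b) (i : σ) : (p.line b i).Splits := by
  refine splits_of_eval_ne_zero_of_im_pos fun t ht => ?_
  rw [MvPolynomial.map_line, MvPolynomial.eval_line]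
  refine hp.isStable.eval_update_ne_zero (b := b) ?_ i ht
  rw [MvPolynomial.eval_map, ← Complex.coe_algebraMap]
  have := MvPolynomial.eval₂_comp_left (algebraMap ℝ ℂ) (RingHom.id ℝ) b p
  rw [RingHom.comp_id, MvPolynomial.eval₂_id] at this
  change MvPolynomial.eval₂ (algebraMap ℝ ℂ) (algebraMap ℝ ℂ ∘ b) p ≠ 0
  rw [← this]
  exact (_root_.map_ne_zero _).mpr (hp.pos b hab).ne'

lemma eval_line_pos (hp : p.StableAbove a) (hab : a ≤ b) (i : σ) {t : ℝ} (ht : a i ≤ t) :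
    0 < (p.line b i).eval t := by
  rw [MvPolynomial.eval_line]
  exact hp.pos _ (le_update_of_le hab ht)

lemma eval_pderiv_nonneg (hp : p.StableAbove a) (hab : a ≤ b) (i : σ) :
    0 ≤ MvPolynomial.eval b (MvPolynomial.pderiv i p) := by
  have hpos := hp.eval_line_pos hab i (hab i)
  have h := (hp.splits_line hab i).eval_derivative_eq_eval_mul_sum hpos.ne'
  rw [MvPolynomial.derivative_line, MvPolynomial.eval_line, Function.update_eq_self] at h
  rw [h]
  refine mul_nonneg hpos.le (Multiset.sum_nonneg fun x hx => ?_)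
  obtain ⟨r, hr, rfl⟩ := Multiset.mem_map.mp hx
  have : r < b i := by
    by_contra! h
    exact (hp.eval_line_pos hab i ((hab i).trans h)).ne' (isRoot_of_mem_roots hr)
  exact one_div_nonneg.mpr (by linarith)

/-- The quotient `∂ⱼ p / p`, restricted to a line in a coordinate direction through a real point,
maps the upper half-plane to the closed lower one. -/
lemma im_line_pderiv_nonpos (hp : p.StableAbove a) (b : σ → ℝ) (i j : σ) {z : ℂ} (hz : 0 < z.im) :
    ((((MvPolynomial.pderiv j p).line b i).map (algebraMap ℝ ℂ)).eval z *
      conj (((p.line b i).map (algebraMap ℝ ℂ)).eval z)).im ≤ 0 := by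
  rw [MvPolynomial.map_line, MvPolynomial.map_line, MvPolynomial.eval_line, MvPolynomial.eval_line]
  set w : σ → ℂ := Function.update (fun k => algebraMap ℝ ℂ (b k)) i z with hw
  set P := MvPolynomial.map (algebraMap ℝ ℂ) p
  rw [← MvPolynomial.pderiv_map]
  have hc : Continuous fun ε : ℝ => (MvPolynomial.eval (fun k => w k + ε * Complex.I)
      (MvPolynomial.pderiv j P) * conj (MvPolynomial.eval (fun k => w k + ε * Complex.I) P)).im :=
    Complex.continuous_im.comp (((MvPolynomial.continuous_eval _).comp (by fun_prop)).mul
      (Complex.continuous_conj.comp ((MvPolynomial.continuous_eval P).comp (by fun_prop))))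
  have h2 := (hc.tendsto 0).mono_left (nhdsWithin_le_nhds (s := Set.Ioi 0))
  simp only [Complex.ofReal_zero, zero_mul, add_zero] at h2
  refine le_of_tendsto h2 ?_
  filter_upwards [self_mem_nhdsWithin] with ε hε
  have hε : 0 < ε := hε
  refine hp.isStable.im_pderiv_mul_conj_nonpos (fun k => ?_) j
  rcases eq_or_ne k i with rfl | h
  · simpa [hw] using add_pos hz hε
  · simpa [hw, h] using hε

lemma antitone_and_tangent_le_line (hp : p.StableAbove a) (hab : a ≤ b) (i j : σ) :
    AntitoneOn (fun t => ((MvPolynomial.pderiv j p).line b i).eval t / (p.line b i).eval t)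
      (Set.Ici (a i)) ∧
    ∀ t u, a i ≤ t → t ≤ u → (u - t) *
      ((((MvPolynomial.pderiv j p).line b i).eval u * (p.line b i).derivative.eval u -
        ((MvPolynomial.pderiv j p).line b i).derivative.eval u * (p.line b i).eval u) /
        (p.line b i).eval u ^ 2) ≤
      ((MvPolynomial.pderiv j p).line b i).eval t / (p.line b i).eval t -
        ((MvPolynomial.pderiv j p).line b i).eval u / (p.line b i).eval u :=
  antitone_and_tangent_le (hp.splits_line hab i) (fun t ht => hp.eval_line_pos hab i ht)
    (fun t ht => by
      rw [MvPolynomial.eval_line]; exact hp.eval_pderiv_nonneg (le_update_of_le hab ht) j)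
    (fun z hz => hp.im_line_pderiv_nonpos b i j hz)

lemma barrier_update_le (hp : p.StableAbove a) (hab : a ≤ b) (i j : σ) {t u : ℝ} (ht : a i ≤ t)
    (htu : t ≤ u) : p.barrier j (Function.update b i u) ≤ p.barrier j (Function.update b i t) := by
  have h := (hp.antitone_and_tangent_le_line hab i j).1 (Set.mem_Ici.mpr ht)
    (Set.mem_Ici.mpr (ht.trans htu)) htu
  simp only [MvPolynomial.eval_line] at h
  exact h

lemma barrier_le_of_le [Fintype σ] (hp : p.StableAbove a) (hab : a ≤ b) (j : σ) :
    p.barrier j b ≤ p.barrier j a := by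
  suffices h : ∀ s : Finset σ, p.barrier j (s.piecewise b a) ≤ p.barrier j a by
    simpa using h Finset.univ
  intro s
  induction s using Finset.induction_on with
  | empty => simp
  | insert i s hi ih =>
    refine le_trans ?_ ih
    have hle : a ≤ s.piecewise b a := Finset.le_piecewise_of_le_of_le _ hab le_rfl
    rw [Finset.piecewise_insert]
    conv_rhs => rw [← Function.update_eq_self i (s.piecewise b a)]
    exact hp.barrier_update_le hle i j (hle i) (by simpa [hi] using hab i)

/-- The barrier step: `1 - ∂ᵢ` keeps stability and does not increase the barrier functions once the
coordinate `i` has been shifted by `δ`, provided that `∂ᵢ log p ≤ 1 - 1 / δ`. -/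
lemma sub_pderiv [Fintype σ] (hp : p.StableAbove a) (i : σ) {δ : ℝ} (hδ : 0 < δ)
    (hi : p.barrier i a ≤ 1 - 1 / δ) :
    (p - MvPolynomial.pderiv i p).StableAbove (Function.update a i (a i + δ)) ∧
    ∀ j, (p - MvPolynomial.pderiv i p).barrier j (Function.update a i (a i + δ)) ≤
      p.barrier j a := by
  have hle : a ≤ Function.update a i (a i + δ) := le_update_of_le le_rfl (by linarith)
  have hlt : 1 - 1 / δ < 1 := by have := one_div_pos.mpr hδ; linarith
  refine ⟨⟨?_, fun b hb => ?_⟩, fun j => ?_⟩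
  · have h := hp.isStable.sub_pderiv i
    rwa [MvPolynomial.pderiv_map, ← map_sub] at h
  · have hab := hle.trans hb
    have h := (hp.barrier_le_of_le hab i).trans hi
    have hpos := hp.pos b hab
    rw [MvPolynomial.barrier, div_le_iff₀ hpos] at h
    rw [map_sub]
    nlinarith
  · set u := a i + δ with hu
    have hbar : p.barrier i (Function.update a i u) ≤ 1 - 1 / δ :=
      (hp.barrier_le_of_le hle i).trans hi
    have hpos := hp.pos _ hle
    have hanti := (hp.antitone_and_tangent_le_line le_rfl i j).1 (Set.mem_Ici.mpr le_rfl)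
      (Set.mem_Ici.mpr (by linarith : a i ≤ u)) (by linarith)
    have htan := (hp.antitone_and_tangent_le_line le_rfl i j).2 (a i) u le_rfl (by linarith)
    have hW := wronskian_nonpos_of_im_nonpos (fun z hz => hp.im_line_pderiv_nonpos a i j hz) u
    simp only [MvPolynomial.derivative_line, MvPolynomial.eval_line, Function.update_eq_self]
      at htan hW
    have hcomm : MvPolynomial.pderiv j (MvPolynomial.pderiv i p)
        = MvPolynomial.pderiv i (MvPolynomial.pderiv j p) := MvPolynomial.pderiv_comm j i p
    unfold MvPolynomial.barrier at hbar ⊢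
    rw [map_sub, map_sub, map_sub, hcomm]
    generalize MvPolynomial.eval (Function.update a i u) p = P at *
    generalize MvPolynomial.eval (Function.update a i u) (MvPolynomial.pderiv i p) = Q at *
    generalize MvPolynomial.eval (Function.update a i u) (MvPolynomial.pderiv j p) = S at *
    generalize MvPolynomial.eval (Function.update a i u)
      (MvPolynomial.pderiv i (MvPolynomial.pderiv j p)) = S' at *
    -- the new barrier is the old one at the shifted point plus `(S Q - S' P) / (P (P - Q))`, which
    -- the tangent inequality for the shift by `δ` compensates
    have hPQ : P / δ ≤ P - Q := by
      rw [div_le_iff₀ hpos] at hbar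
      have : P / δ = P * (1 / δ) := by ring
      nlinarith
    have hPQ0 : 0 < P - Q := lt_of_lt_of_le (by positivity) hPQ
    have h1 : (S - S') / (P - Q) = S / P + (S * Q - S' * P) / (P * (P - Q)) := by
      field_simp
      ring
    have h2 : (S * Q - S' * P) / (P * (P - Q)) ≤ (S * Q - S' * P) / (P * (P / δ)) :=
      div_le_div_of_nonneg_left (by linarith) (by positivity)
        (mul_le_mul_of_nonneg_left hPQ hpos.le)
    have h3 : (u - a i) * ((S * Q - S' * P) / P ^ 2) = (S * Q - S' * P) / (P * (P / δ)) := by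
      rw [hu]
      field_simp
      ring
    rw [h3] at htan
    rw [h1]
    linarith

end MvPolynomial.StableAbove
end Stable

/-! ### Random colourings and the operator `∏ (1 - ∂ᵢ)` -/

section Operators
variable {σ R S : Type*} [CommRing R] [CommRing S]

/-- The operator `∏_{i ∈ l} (1 - ∂ᵢ)`. -/
noncomputable def oneSubPDerivs (l : List σ) (p : MvPolynomial σ R) : MvPolynomial σ R :=
  l.foldr (fun i q => q - MvPolynomial.pderiv i q) p

lemma oneSubPDerivs_cons (i : σ) (l : List σ) (p : MvPolynomial σ R) :
    oneSubPDerivs (i :: l) p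
      = oneSubPDerivs l p - MvPolynomial.pderiv i (oneSubPDerivs l p) := rfl

lemma map_oneSubPDerivs (f : R →+* S) (l : List σ) (p : MvPolynomial σ R) :
    MvPolynomial.map f (oneSubPDerivs l p) = oneSubPDerivs l (MvPolynomial.map f p) := by
  induction l with
  | nil => rfl
  | cons i l ih => rw [oneSubPDerivs_cons, oneSubPDerivs_cons, map_sub, ih, ← MvPolynomial.pderiv_map, ih]

variable [DecidableEq σ]

lemma MvPolynomial.IsStable.oneSubPDerivs {p : MvPolynomial σ ℂ} {c : ℝ} (hp : p.IsStable c)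
    (l : List σ) : (oneSubPDerivs l p).IsStable c := by
  induction l with
  | nil => exact hp
  | cons i l ih => exact ih.sub_pderiv i

/-- Applying all the operators `1 - ∂ᵢ` moves the corner of the positivity orthant from `-δ` to the
origin. -/
lemma eval_zero_oneSubPDerivs_pos [Fintype σ] {p : MvPolynomial σ ℝ} {δ : ℝ} (hδ : 0 < δ)
    (hp : p.StableAbove fun _ => -δ) (hb : ∀ j, p.barrier j (fun _ => -δ) ≤ 1 - 1 / δ) :
    0 < MvPolynomial.eval 0 (oneSubPDerivs Finset.univ.toList p) := by
  -- the coordinates in `l`, whose operators have been applied, have been moved to `0`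
  have key : ∀ l : List σ, l.Nodup →
      (oneSubPDerivs l p).StableAbove (fun j => if j ∈ l then 0 else -δ) ∧
      ∀ j, (oneSubPDerivs l p).barrier j (fun j => if j ∈ l then 0 else -δ) ≤ 1 - 1 / δ := by
    intro l
    induction l with
    | nil => exact fun _ => by simpa [oneSubPDerivs] using And.intro hp (by simpa using hb)
    | cons i l ih =>
      intro hl
      obtain ⟨hi, hl⟩ := List.nodup_cons.mp hl
      obtain ⟨h1, h2⟩ := ih hl
      have h := h1.sub_pderiv i hδ (h2 i)
      have e : Function.update (fun j => if j ∈ l then 0 else -δ) i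
          ((fun j => if j ∈ l then 0 else -δ) i + δ) = fun j => if j ∈ i :: l then 0 else -δ := by
        funext j
        rcases eq_or_ne j i with rfl | hj
        · simp [hi]
        · simp [hj]
      rw [e] at h
      exact ⟨h.1, fun j => (h.2 j).trans (h2 j)⟩
  have h := (key Finset.univ.toList (Finset.nodup_toList _)).1.pos 0
    (fun j => by simp)
  exact h

end Operators

section Expansion
variable {σ κ : Type*} [Fintype σ] [DecidableEq σ]

lemma prod_update_mul {R : Type*} [CommRing R] (w : σ → κ → R) (c : σ → κ) (i : σ) (k : κ) :
    (∏ j, w j (Function.update c i k j)) * w i (c i) = (∏ j, w j (c j)) * w i k := by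
  rw [← Finset.mul_prod_erase _ _ (Finset.mem_univ i),
    ← Finset.mul_prod_erase _ (fun j => w j (c j)) (Finset.mem_univ i)]
  have : ∏ j ∈ Finset.univ.erase i, w j (Function.update c i k j)
      = ∏ j ∈ Finset.univ.erase i, w j (c j) := Finset.prod_congr rfl fun j hj => by
    rw [Function.update_of_ne (Finset.ne_of_mem_erase hj)]
  rw [this, Function.update_self]
  ring

variable [Fintype κ]

/-- Resampling one coordinate of a random colouring with independent colours. -/
lemma sum_prod_mul_resample {R : Type*} [CommRing R] (w : σ → κ → R) (i : σ)
    (hw : ∑ k, w i k = 1) (Ψ : (σ → κ) → κ → R)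
    (hΨ : ∀ c m k, Ψ (Function.update c i m) k = Ψ c k) :
    ∑ c : σ → κ, (∏ j, w j (c j)) * ∑ k, w i k * Ψ c k
      = ∑ c : σ → κ, (∏ j, w j (c j)) * Ψ c (c i) := by
  have hinv : Function.Involutive
      (fun x : (σ → κ) × κ => (Function.update x.1 i x.2, x.1 i)) := fun x => by
    simp
  have h1 : ∑ c : σ → κ, (∏ j, w j (c j)) * ∑ k, w i k * Ψ c k
      = ∑ x : (σ → κ) × κ, (∏ j, w j (x.1 j)) * w i x.2 * Ψ x.1 x.2 := by
    rw [Fintype.sum_prod_type]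
    simp only [Finset.mul_sum, mul_assoc]
  have h2 : ∑ c : σ → κ, (∏ j, w j (c j)) * Ψ c (c i)
      = ∑ x : (σ → κ) × κ, (∏ j, w j (x.1 j)) * w i x.2 * Ψ x.1 (x.1 i) := by
    rw [Fintype.sum_prod_type]
    refine Finset.sum_congr rfl fun c _ => ?_
    simp only
    rw [← Finset.sum_mul, ← Finset.mul_sum, hw, mul_one]
  rw [h1, h2]
  refine Fintype.sum_equiv hinv.toPerm _ _ fun x => ?_
  simp only [Function.Involutive.coe_toPerm]
  rw [prod_update_mul, hΨ, Function.update_self]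

/-- The operator `1 - d/ds` at `s = 0`, applied to the product of the affine functions
`aₖ + r lₖ bₖ s`, yields the average over `k`, with weights `lₖ`, of the product in which `aₖ - r bₖ`
replaces the factor `aₖ` of `∏ₘ aₘ`. -/
lemma eval_sub_derivative_prod {R : Type*} [DecidableEq κ] [CommRing R] (a b l : κ → R) (r : R)
    (hl : ∑ k, l k = 1) :
    (∏ k, (C (a k) + C (r * l k * b k) * X)).eval 0
      - (derivative (∏ k, (C (a k) + C (r * l k * b k) * X))).eval 0
      = ∑ k, l k * ∏ m, (a m + (if k = m then -r else 0) * b m) := by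
  have h1 : ∀ k, ∏ m, (a m + (if k = m then -r else 0) * b m)
      = ∏ m, a m - r * b k * ∏ m ∈ Finset.univ.erase k, a m := fun k => by
    rw [← Finset.mul_prod_erase _ _ (Finset.mem_univ k), ← Finset.mul_prod_erase _ a (Finset.mem_univ k)]
    have : ∏ m ∈ Finset.univ.erase k, (a m + (if k = m then -r else 0) * b m)
        = ∏ m ∈ Finset.univ.erase k, a m := Finset.prod_congr rfl fun m hm => by
      rw [if_neg (Finset.ne_of_mem_erase hm).symm, zero_mul, add_zero]
    rw [this, if_pos rfl]
    ring
  simp only [h1, mul_sub, Finset.sum_sub_distrib, ← Finset.sum_mul, hl, one_mul]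
  rw [derivative_prod_finset]
  simp only [eval_prod, eval_finsetSum, eval_mul, eval_add, eval_C, eval_X, mul_zero, add_zero,
    derivative_add, derivative_C, zero_add, derivative_C_mul, derivative_X, mul_one]
  congr 1
  exact Finset.sum_congr rfl fun k _ => by ring

/-- `det (x + Y A)` for the diagonal matrix `Y` with entries `y`. -/
noncomputable def pencilDet {R : Type*} [CommRing R] (A : Matrix σ σ R) (x : R) (y : σ → R) : R :=
  (x • (1 : Matrix σ σ R) + Matrix.diagonal y * A).det

/-- The determinant `det (x + Y A)` is affine in each diagonal entry of `Y`. -/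
lemma pencilDet_update {R : Type*} [CommRing R] (A : Matrix σ σ R) (x : R) (y : σ → R) (i : σ)
    (s : R) : pencilDet A x (Function.update y i s) = pencilDet A x (Function.update y i 0)
      + s * (pencilDet A x (Function.update y i 1) - pencilDet A x (Function.update y i 0)) := by
  have h : ∀ s, x • (1 : Matrix σ σ R) + Matrix.diagonal (Function.update y i s) * A
      = (x • (1 : Matrix σ σ R) + Matrix.diagonal y * A).updateRow i
        ((x • (1 : Matrix σ σ R)) i + s • A i) := fun s => by
    ext j k
    rcases eq_or_ne j i with rfl | hj
    · simp [Matrix.diagonal_mul]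
    · simp [Matrix.diagonal_mul, hj]
  simp only [pencilDet, h, Matrix.det_updateRow_add, Matrix.det_updateRow_smul]
  ring

/-- The polynomial `∏ₖ det (x + diag (wᵢₖ tᵢ) A)` in the variables `tᵢ`. -/
noncomputable def colorPoly (A : Matrix σ σ ℂ) (x : ℂ) (w : σ → κ → ℂ) : MvPolynomial σ ℂ :=
  ∏ k, pencilDet (A.map MvPolynomial.C) (MvPolynomial.C x)
    (fun i => MvPolynomial.C (w i k) * MvPolynomial.X i)

lemma eval_colorPoly (A : Matrix σ σ ℂ) (x : ℂ) (w : σ → κ → ℂ) (t : σ → ℂ) :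
    MvPolynomial.eval t (colorPoly A x w) = ∏ k, pencilDet A x (fun i => w i k * t i) := by
  rw [colorPoly, map_prod]
  refine Finset.prod_congr rfl fun k _ => ?_
  rw [pencilDet, RingHom.map_det, pencilDet]
  congr 1
  ext i j
  simp [Matrix.diagonal_mul, Matrix.one_apply, apply_ite]

/-- The average of `∏ₖ det (x - r Dₖ A)`, with `Dₖ` the projection to the `k`-th colour class of a
random colouring with independent colours of laws `l i`, is a mixed characteristic polynomial. -/
lemma eval_zero_oneSubPDerivs_colorPoly [DecidableEq κ] (A : Matrix σ σ ℂ) (x r : ℂ) (w : σ → κ → ℂ)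
    (hw : ∀ i, ∑ k, w i k = 1) :
    MvPolynomial.eval 0 (oneSubPDerivs Finset.univ.toList (colorPoly A x fun i k => r * w i k))
      = ∑ c : σ → κ, (∏ i, w i (c i)) * ∏ k, pencilDet A x (fun i => if c i = k then -r else 0) := by
  -- once `1 - ∂ᵢ` has been applied for `i ∈ l`, these coordinates carry a random colour, while the
  -- others still have the values `r wᵢₖ tᵢ`
  have key : ∀ l : List σ, l.Nodup → ∀ t : σ → ℂ, (∀ i ∈ l, t i = 0) →
      MvPolynomial.eval t (oneSubPDerivs l (colorPoly A x fun i k => r * w i k))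
        = ∑ c : σ → κ, (∏ i, w i (c i)) * ∏ k, pencilDet A x
          (fun i => if i ∈ l then (if c i = k then -r else 0) else r * w i k * t i) := by
    intro l
    induction l with
    | nil =>
      intro _ t _
      simp only [List.not_mem_nil, if_false]
      rw [← Finset.sum_mul, ← Fintype.prod_sum, Finset.prod_congr rfl fun i _ => hw i,
        Finset.prod_const_one, one_mul]
      exact eval_colorPoly A x _ t
    | cons i l ih =>
      intro hl t ht
      obtain ⟨hi, hl⟩ := List.nodup_cons.mp hl
      set P := oneSubPDerivs l (colorPoly A x fun i k => r * w i k) with hP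
      set y : (σ → κ) → κ → σ → ℂ := fun c k j =>
        if j ∈ l then (if c j = k then -r else 0) else r * w j k * t j with hy
      set a : (σ → κ) → κ → ℂ := fun c k => pencilDet A x (Function.update (y c k) i 0) with ha
      set b : (σ → κ) → κ → ℂ := fun c k => pencilDet A x (Function.update (y c k) i 1) - a c k
        with hb
      have hline : P.line t i = ∑ c : σ → κ, C (∏ j, w j (c j)) *
          ∏ k, (C (a c k) + C (r * w i k * b c k) * X) := by
        refine Polynomial.funext fun s => ?_
        rw [MvPolynomial.eval_line, ih hl _ fun j hj => by
          rw [Function.update_of_ne (ne_of_mem_of_not_mem hj hi)]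
          exact ht j (List.mem_cons_of_mem _ hj)]
        simp only [eval_finsetSum, eval_mul, eval_prod, eval_add, eval_C, eval_X]
        refine Finset.sum_congr rfl fun c _ => ?_
        congr 1
        refine Finset.prod_congr rfl fun k _ => ?_
        have e : (fun j => if j ∈ l then (if c j = k then -r else 0)
            else r * w j k * Function.update t i s j)
            = Function.update (y c k) i (r * w i k * s) := by
          funext j
          rcases eq_or_ne j i with rfl | hj
          · simp [hi]
          · simp [hj, hy]
        rw [e, pencilDet_update]
        ring
      have ht0 : t i = 0 := ht i (by simp)
      have h1 : MvPolynomial.eval t (oneSubPDerivs (i :: l) (colorPoly A x fun i k => r * w i k))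
          = (P.line t i).eval 0 - (derivative (P.line t i)).eval 0 := by
        rw [MvPolynomial.derivative_line, MvPolynomial.eval_line, MvPolynomial.eval_line, ← ht0,
          Function.update_eq_self, ← map_sub]
        rfl
      have h2 : (P.line t i).eval 0 - (derivative (P.line t i)).eval 0
          = ∑ c : σ → κ, (∏ j, w j (c j)) * ∑ k, w i k *
            ∏ m, (a c m + (if k = m then -r else 0) * b c m) := by
        rw [hline]
        simp only [derivative_sum, derivative_C_mul, eval_finsetSum, eval_mul (p := C _), eval_C]
        rw [← Finset.sum_sub_distrib]
        refine Finset.sum_congr rfl fun c _ => ?_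
        rw [← mul_sub, eval_sub_derivative_prod _ _ _ _ (hw i)]
      have hyup : ∀ c m k, Function.update (y (Function.update c i m) k) i
          = Function.update (y c k) i := fun c m k => by
        funext s j
        rcases eq_or_ne j i with rfl | hj
        · simp
        · simp [hj, hy]
      rw [h1, h2, sum_prod_mul_resample w i (hw i) _ fun c m k => by
        simp only [ha, hb, hyup]]
      refine Finset.sum_congr rfl fun c _ => ?_
      congr 1
      refine Finset.prod_congr rfl fun m _ => ?_
      rw [← pencilDet_update]
      congr 1
      funext j
      rcases eq_or_ne j i with rfl | hj
      · simp
      · simp [hj, hy]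
  rw [key _ (Finset.nodup_toList _) 0 fun _ _ => rfl]
  simp

end Expansion

/-! ### The determinant `det (x + Y A)` of a positive contraction -/

open Matrix

section Pencil
variable {σ : Type*} {A : Matrix σ σ ℂ}

/-- A complex polynomial commuting with conjugation has real coefficients. -/
lemma exists_map_ofReal_eq {P : MvPolynomial σ ℂ}
    (h : ∀ z, conj (MvPolynomial.eval z P) = MvPolynomial.eval (fun i => conj (z i)) P) :
    ∃ p : MvPolynomial σ ℝ, MvPolynomial.map (algebraMap ℝ ℂ) p = P := by
  have hP : MvPolynomial.map conj P = P := by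
    refine MvPolynomial.funext fun z => ?_
    have h1 := h fun i => conj (z i)
    simp only [Complex.conj_conj] at h1
    rw [← h1, MvPolynomial.eval_map, ← MvPolynomial.eval₂_id (R := ℂ), MvPolynomial.hom_eval₂]
    congr 1
    funext i
    simp
  have : P ∈ Set.range (MvPolynomial.map (algebraMap ℝ ℂ)) := by
    rw [MvPolynomial.mem_range_map_iff_coeffs_subset]
    intro c hc
    obtain ⟨m, -, rfl⟩ := MvPolynomial.mem_coeffs_iff.mp hc
    have h2 := congrArg (MvPolynomial.coeff m) hP
    rw [MvPolynomial.coeff_map] at h2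
    exact ⟨(MvPolynomial.coeff m P).re, Complex.conj_eq_iff_re.mp h2⟩
  exact this

lemma eval_ofReal_map (p : MvPolynomial σ ℝ) (b : σ → ℝ) :
    MvPolynomial.eval (fun i => (b i : ℂ)) (MvPolynomial.map (algebraMap ℝ ℂ) p)
      = ((MvPolynomial.eval b p : ℝ) : ℂ) := by
  rw [MvPolynomial.eval_map, ← MvPolynomial.eval₂_id (R := ℝ), ← Complex.coe_algebraMap,
    MvPolynomial.hom_eval₂]
  rfl

variable [Fintype σ]

lemma Matrix.PosSemidef.ofReal_re_dotProduct (hA : A.PosSemidef) (v : σ → ℂ) :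
    (((star v ⬝ᵥ A *ᵥ v).re : ℝ) : ℂ) = star v ⬝ᵥ A *ᵥ v :=
  (Complex.eq_re_of_ofReal_le (r := 0) (by simpa using hA.dotProduct_mulVec_nonneg v)).symm

lemma re_star_dotProduct_self (v : σ → ℂ) : (star v ⬝ᵥ v).re = ∑ i, ‖v i‖ ^ 2 := by
  simp only [dotProduct, Complex.re_sum, Pi.star_apply]
  refine Finset.sum_congr rfl fun i _ => ?_
  rw [Complex.star_def, Complex.conj_mul', ← Complex.ofReal_pow, Complex.ofReal_re]

variable [DecidableEq σ]

open scoped MatrixOrder Matrix.Norms.L2Operator in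
/-- The Cauchy–Schwarz inequality for the form of a positive semidefinite matrix. -/
lemma Matrix.PosSemidef.norm_dotProduct_sq_le (hA : A.PosSemidef) (u v : σ → ℂ) :
    ‖star u ⬝ᵥ A *ᵥ v‖ ^ 2 ≤ (star u ⬝ᵥ A *ᵥ u).re * (star v ⬝ᵥ A *ᵥ v).re := by
  obtain ⟨B, rfl⟩ := CStarAlgebra.nonneg_iff_eq_star_mul_self.mp hA.nonneg
  rw [star_eq_conjTranspose]
  have h : ∀ u v : σ → ℂ, star u ⬝ᵥ (Bᴴ * B) *ᵥ v = star (B *ᵥ u) ⬝ᵥ (B *ᵥ v) := fun u v => by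
    rw [← mulVec_mulVec, dotProduct_mulVec, ← star_mulVec]
  simp only [h]
  generalize B *ᵥ u = x
  generalize B *ᵥ v = y
  have h1 := norm_inner_le_norm (𝕜 := ℂ) (WithLp.toLp 2 x) (WithLp.toLp 2 y)
  rw [EuclideanSpace.inner_toLp_toLp, dotProduct_comm] at h1
  rw [re_star_dotProduct_self, re_star_dotProduct_self]
  calc _ ≤ (‖WithLp.toLp 2 x‖ * ‖WithLp.toLp 2 y‖) ^ 2 := by gcongr
    _ = _ := by rw [mul_pow, EuclideanSpace.norm_sq_eq, EuclideanSpace.norm_sq_eq]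

/-- The inequality `|(A v) i|² ≤ A i i * ⟨v, A v⟩`, which is where the size of the diagonal
entries enters the barrier bound. -/
lemma Matrix.PosSemidef.norm_mulVec_apply_sq_le (hA : A.PosSemidef) (v : σ → ℂ) (i : σ) :
    ‖(A *ᵥ v) i‖ ^ 2 ≤ (A i i).re * (star v ⬝ᵥ A *ᵥ v).re := by
  have h := hA.norm_dotProduct_sq_le (Pi.single i 1) v
  have e : star (Pi.single i (1 : ℂ) : σ → ℂ) = Pi.single i (1 : ℂ) := by
    rw [← Pi.single_star, star_one]
  rw [e, single_one_dotProduct, single_one_dotProduct, mulVec_single_one] at h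
  exact h

lemma Matrix.PosSemidef.sum_norm_mulVec_sq_le (hA : A.PosSemidef) (hA1 : (1 - A).PosSemidef)
    (v : σ → ℂ) : ∑ i, ‖(A *ᵥ v) i‖ ^ 2 ≤ (star v ⬝ᵥ A *ᵥ v).re := by
  set w := A *ᵥ v with hw
  set S := ∑ i, ‖w i‖ ^ 2 with hS
  have hS0 : 0 ≤ S := Finset.sum_nonneg fun i _ => by positivity
  have h1 := hA.norm_dotProduct_sq_le w v
  have h2 : (star w ⬝ᵥ A *ᵥ w).re ≤ S := by
    have h := (Complex.le_def.mp (hA1.dotProduct_mulVec_nonneg w)).1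
    rw [sub_mulVec, one_mulVec, dotProduct_sub, Complex.sub_re, re_star_dotProduct_self,
      Complex.zero_re] at h
    linarith
  have hQ : 0 ≤ (star v ⬝ᵥ A *ᵥ v).re := (Complex.le_def.mp (hA.dotProduct_mulVec_nonneg v)).1
  have h3 : S ≤ ‖star w ⬝ᵥ A *ᵥ v‖ := by
    rw [hS, ← re_star_dotProduct_self]
    exact Complex.re_le_norm _
  have h4 : S ^ 2 ≤ S * (star v ⬝ᵥ A *ᵥ v).re :=
    (pow_le_pow_left₀ hS0 h3 2).trans (h1.trans (mul_le_mul_of_nonneg_right h2 hQ))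
  rcases hS0.eq_or_lt with h | h
  · rw [← h]; exact hQ
  · nlinarith

/-- A zero of `det (x + Y A)` yields a vector `v` with `x ⟨v, A v⟩ + ⟨A v, Y A v⟩ = 0`. -/
lemma exists_of_pencilDet_eq_zero (hA : A.PosSemidef) {x : ℂ} (hx : x ≠ 0) {y : σ → ℂ}
    (h : pencilDet A x y = 0) : ∃ v : σ → ℂ, 0 < ∑ i, ‖(A *ᵥ v) i‖ ^ 2 ∧
      x * ((star v ⬝ᵥ A *ᵥ v).re : ℂ) + ∑ i, y i * ((‖(A *ᵥ v) i‖ ^ 2 : ℝ) : ℂ) = 0 := by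
  obtain ⟨v, hv, h0⟩ := Matrix.exists_mulVec_eq_zero_iff.mpr h
  rw [add_mulVec, smul_mulVec, one_mulVec, ← mulVec_mulVec] at h0
  refine ⟨v, ?_, ?_⟩
  · refine lt_of_le_of_ne (Finset.sum_nonneg fun i _ => by positivity) fun h1 => hv ?_
    have h2 : A *ᵥ v = 0 := by
      funext i
      have := (Finset.sum_eq_zero_iff_of_nonneg fun i _ => by positivity).mp h1.symm i
        (Finset.mem_univ i)
      simpa using this
    rw [h2, mulVec_zero, add_zero] at h0
    exact (smul_eq_zero.mp h0).resolve_left hx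
  · have h1 := congrArg (fun u => star (A *ᵥ v) ⬝ᵥ u) h0
    simp only [dotProduct_add, dotProduct_smul, dotProduct_zero, smul_eq_mul] at h1
    have h2 : star (A *ᵥ v) ⬝ᵥ v = star v ⬝ᵥ A *ᵥ v := by
      rw [star_mulVec, hA.isHermitian.eq, ← dotProduct_mulVec]
    rw [h2] at h1
    rw [hA.ofReal_re_dotProduct, ← h1]
    congr 1
    refine Finset.sum_congr rfl fun i _ => ?_
    rw [mulVec_diagonal, Pi.star_apply, Complex.star_def, mul_left_comm, Complex.conj_mul',
      Complex.ofReal_pow]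

/-- The imaginary part of `x ⟨v, A v⟩ + ⟨A v, Y A v⟩` is positive, since `⟨v, A v⟩ ≥ ‖A v‖²`. -/
lemma pencilDet_ne_zero_of_im_pos (hA : A.PosSemidef) (hA1 : (1 - A).PosSemidef) {x : ℂ}
    (hx : 0 < x.im) {y : σ → ℂ} (hy : ∀ i, -x.im < (y i).im) : pencilDet A x y ≠ 0 := by
  intro h
  obtain ⟨v, hv, h0⟩ := exists_of_pencilDet_eq_zero hA (fun h => by simp [h] at hx) h
  have him := congrArg Complex.im h0
  simp only [Complex.add_im, Complex.im_mul_ofReal, Complex.im_sum, Complex.zero_im] at him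
  have h1 : ∑ i, -x.im * ‖(A *ᵥ v) i‖ ^ 2 < ∑ i, (y i).im * ‖(A *ᵥ v) i‖ ^ 2 := by
    obtain ⟨i, -, hi⟩ := Finset.exists_lt_of_sum_lt
      (f := fun _ => (0 : ℝ)) (g := fun i => ‖(A *ᵥ v) i‖ ^ 2) (s := Finset.univ) (by simpa using hv)
    exact Finset.sum_lt_sum (fun i _ => mul_le_mul_of_nonneg_right (hy i).le (by positivity))
      ⟨i, Finset.mem_univ i, mul_lt_mul_of_pos_right (hy i) hi⟩
  rw [← Finset.mul_sum] at h1
  have h2 := mul_le_mul_of_nonneg_left (hA.sum_norm_mulVec_sq_le hA1 v) hx.le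
  linarith

lemma pencilDet_ofReal_ne_zero_of_im_pos (hA : A.PosSemidef) {x : ℝ} (hx : 0 < x) {y : σ → ℂ}
    (hy : ∀ i, 0 < (y i).im) : pencilDet A x y ≠ 0 := by
  intro h
  obtain ⟨v, hv, h0⟩ := exists_of_pencilDet_eq_zero hA (by exact_mod_cast hx.ne') h
  have him := congrArg Complex.im h0
  simp only [Complex.add_im, Complex.im_mul_ofReal, Complex.im_sum, Complex.zero_im,
    Complex.ofReal_im, zero_mul, zero_add] at him
  obtain ⟨i, -, hi⟩ := Finset.exists_lt_of_sum_lt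
    (f := fun _ => (0 : ℝ)) (g := fun i => ‖(A *ᵥ v) i‖ ^ 2) (s := Finset.univ) (by simpa using hv)
  have h1 : 0 < ∑ i, (y i).im * ‖(A *ᵥ v) i‖ ^ 2 :=
    Finset.sum_pos' (fun i _ => mul_nonneg (hy i).le (by positivity))
      ⟨i, Finset.mem_univ i, mul_pos (hy i) hi⟩
  exact h1.ne' him

/-- Real points at which `det (x + Y A)` cannot vanish: above the corner `-δ` in all coordinates but
one, which may go down to `-δ - (x - δ) / α`. -/
lemma pencilDet_ofReal_ne_zero (hA : A.PosSemidef) (hA1 : (1 - A).PosSemidef) {x δ α : ℝ}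
    (hδ : 0 ≤ δ) (hx : δ < x) {y : σ → ℝ} (i : σ) (hα : (A i i).re ≤ α)
    (hy : ∀ j, j ≠ i → -δ ≤ y j) (hi : -(x - δ) < (y i + δ) * α) :
    pencilDet A x (fun j => (y j : ℂ)) ≠ 0 := by
  intro h
  obtain ⟨v, hv, h0⟩ := exists_of_pencilDet_eq_zero hA
    (by exact_mod_cast (hδ.trans_lt hx).ne') h
  have h1 : x * (star v ⬝ᵥ A *ᵥ v).re + ∑ j, y j * ‖(A *ᵥ v) j‖ ^ 2 = 0 := by exact_mod_cast h0
  have hS := hA.sum_norm_mulVec_sq_le hA1 v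
  have hw := hA.norm_mulVec_apply_sq_le v i
  set Q := (star v ⬝ᵥ A *ᵥ v).re
  have hQ : 0 < Q := hv.trans_le hS
  have h2 : ∑ j, (y j + δ) * ‖(A *ᵥ v) j‖ ^ 2
      = (∑ j, y j * ‖(A *ᵥ v) j‖ ^ 2) + δ * ∑ j, ‖(A *ᵥ v) j‖ ^ 2 := by
    rw [Finset.mul_sum, ← Finset.sum_add_distrib]
    exact Finset.sum_congr rfl fun j _ => by ring
  have h3 : (y i + δ) * ‖(A *ᵥ v) i‖ ^ 2 ≤ ∑ j, (y j + δ) * ‖(A *ᵥ v) j‖ ^ 2 := by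
    rw [← Finset.add_sum_erase _ _ (Finset.mem_univ i)]
    refine le_add_of_nonneg_right (Finset.sum_nonneg fun j hj => mul_nonneg ?_ (by positivity))
    linarith [hy j (Finset.ne_of_mem_erase hj)]
  have h4 := mul_le_mul_of_nonneg_left hS hδ
  have h5 : 0 ≤ ‖(A *ᵥ v) i‖ ^ 2 := by positivity
  have h6 : -(x - δ) * Q < (y i + δ) * ‖(A *ᵥ v) i‖ ^ 2 := by
    rcases le_or_gt 0 (y i + δ) with h | h
    · have := mul_nonneg h h5
      nlinarith
    · have h7 : ‖(A *ᵥ v) i‖ ^ 2 ≤ α * Q := hw.trans (mul_le_mul_of_nonneg_right hα hQ.le)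
      nlinarith [mul_le_mul_of_nonpos_left h7 h.le, mul_lt_mul_of_pos_right hi hQ]
  nlinarith

lemma pencilDet_eq_eval_charpoly {R : Type*} [CommRing R] (A : Matrix σ σ R) (x : R) (y : σ → R) :
    pencilDet A x y = (-(Matrix.diagonal y) * A).charpoly.eval x := by
  rw [pencilDet, Matrix.eval_charpoly, Matrix.neg_mul, sub_neg_eq_add, Matrix.scalar_apply,
    Matrix.smul_one_eq_diagonal]

/-- The coefficients of `det (x + Y A)` are real for Hermitian `A` and real `x`: transposition
exchanges the factors `Y` and `A`, which does not change the determinant. -/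
lemma conj_pencilDet (hA : A.IsHermitian) (x : ℂ) (y : σ → ℂ) :
    conj (pencilDet A x y) = pencilDet A (conj x) (fun i => conj (y i)) := by
  rw [pencilDet_eq_eval_charpoly A (conj x), Matrix.charpoly_mul_comm, Matrix.eval_charpoly,
    pencilDet, ← Complex.star_def, ← Matrix.det_conjTranspose]
  congr 1
  rw [conjTranspose_add, conjTranspose_mul, conjTranspose_smul, conjTranspose_one, hA.eq,
    Matrix.diagonal_conjTranspose, Matrix.mul_neg, sub_neg_eq_add, Matrix.scalar_apply,
    Matrix.smul_one_eq_diagonal]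
  rfl

/-- Above the corner `-δ`, with `δ < x`, the real polynomial `det (x + diag (tᵢ) A)` is stable, and
its barrier functions at the corner are at most `α / (x - δ)`: it is affine in each variable, with
its zero at distance at least `(x - δ) / α` from `-δ`. -/
lemma exists_stableAbove_pencilDet (hA : A.PosSemidef) (hA1 : (1 - A).PosSemidef) {x δ α : ℝ}
    (hδ : 0 ≤ δ) (hx : δ < x) (hα0 : 0 < α) (hα : ∀ i, (A i i).re ≤ α) :
    ∃ p : MvPolynomial σ ℝ, (∀ z, MvPolynomial.eval z (MvPolynomial.map (algebraMap ℝ ℂ) p)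
        = pencilDet A x z) ∧
      p.StableAbove (fun _ => -δ) ∧ ∀ j, p.barrier j (fun _ => -δ) ≤ α / (x - δ) := by
  set P : MvPolynomial σ ℂ := pencilDet (A.map MvPolynomial.C) (MvPolynomial.C (x : ℂ))
    MvPolynomial.X with hPdef
  have hP : ∀ z, MvPolynomial.eval z P = pencilDet A x z := fun z => by
    have h := eval_colorPoly (κ := Unit) A x (fun _ _ => 1) z
    simpa [colorPoly] using h
  obtain ⟨p, hp⟩ := exists_map_ofReal_eq (P := P) fun z => by
    rw [hP, hP, conj_pencilDet hA.isHermitian, Complex.conj_ofReal]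
  have hev : ∀ b : σ → ℝ, ((MvPolynomial.eval b p : ℝ) : ℂ) = pencilDet A x (fun i => (b i : ℂ)) :=
    fun b => by rw [← eval_ofReal_map, hp, hP]
  have hne : ∀ b : σ → ℝ, ∀ i, (∀ j, j ≠ i → -δ ≤ b j) → -(x - δ) < (b i + δ) * α →
      MvPolynomial.eval b p ≠ 0 := fun b i h1 h2 h3 => by
    refine pencilDet_ofReal_ne_zero hA hA1 hδ hx i (hα i) h1 h2 ?_
    rw [← hev, h3, Complex.ofReal_zero]
  have h0 : 0 < MvPolynomial.eval 0 p := by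
    have h := hev 0
    have e : pencilDet A x (fun i => (((0 : σ → ℝ) i : ℝ) : ℂ)) = ((x ^ Fintype.card σ : ℝ) : ℂ) := by
      simp [pencilDet]
    rw [e] at h
    rw [Complex.ofReal_inj.mp h]
    exact pow_pos (hδ.trans_lt hx) _
  -- a real polynomial that does not vanish along a path keeps its sign
  have hsegment : ∀ f : ℝ → σ → ℝ, Continuous f → 0 < MvPolynomial.eval (f 0) p →
      (∀ s ∈ Set.Icc (0 : ℝ) 1, MvPolynomial.eval (f s) p ≠ 0) → 0 < MvPolynomial.eval (f 1) p := by
    intro f hf hf0 hfs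
    by_contra! hneg
    obtain ⟨s, hs, hs0⟩ := intermediate_value_Icc' zero_le_one
      ((MvPolynomial.continuous_eval p).comp hf).continuousOn ⟨hneg, hf0.le⟩
    exact hfs s hs hs0
  have hpos : ∀ b : σ → ℝ, (∀ j, -δ ≤ b j) → 0 < MvPolynomial.eval b p := fun b hb => by
    rcases isEmpty_or_nonempty σ with hσ | ⟨⟨i⟩⟩
    · rwa [Subsingleton.elim b 0]
    · have h := hsegment (fun s => s • b) (by fun_prop) (by simpa using h0) fun s hs => by
        have hsb : ∀ j, -δ ≤ s * b j := fun j => by nlinarith [hb j, hs.1, hs.2]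
        refine hne _ i (fun j _ => hsb j) ?_
        have := mul_nonneg (by linarith [hsb i] : 0 ≤ s * b i + δ) hα0.le
        simp only [Pi.smul_apply, smul_eq_mul]
        linarith
      simpa using h
  refine ⟨p, fun z => by rw [hp, hP], ⟨fun z hz => ?_, fun b hb => hpos b hb⟩, fun j => ?_⟩
  · rw [hp, hP]
    exact pencilDet_ofReal_ne_zero_of_im_pos hA (hδ.trans_lt hx) hz
  · set a : σ → ℝ := fun _ => -δ with ha
    set q := p.line a j with hq
    set m := q.eval 1 - q.eval 0 with hm
    have haff : q = C (q.eval 0) + C m * X := by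
      refine Polynomial.funext fun s => ?_
      have h := pencilDet_update A x (fun i => (a i : ℂ)) j (s : ℂ)
      have e : ∀ s : ℝ, pencilDet A x (Function.update (fun i => (a i : ℂ)) j (s : ℂ))
          = ((q.eval s : ℝ) : ℂ) := fun s => by
        rw [hq, MvPolynomial.eval_line, hev]
        congr 1
        funext i
        rcases eq_or_ne i j with rfl | hi
        · simp
        · simp [hi]
      have e0 := e 0
      have e1 := e 1
      rw [Complex.ofReal_zero] at e0
      rw [Complex.ofReal_one] at e1
      rw [e, e0, e1] at h
      have h' : q.eval s = q.eval 0 + s * (q.eval 1 - q.eval 0) := by exact_mod_cast h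
      rw [h']
      simp [hm]
      ring
    have hline : ∀ t, q.eval t = q.eval 0 + m * t := fun t => by
      conv_lhs => rw [haff]
      simp
    have hbar : p.barrier j a = m / q.eval (-δ) := by
      have h1 : q.derivative.eval (-δ) = m := by
        rw [haff]
        simp
      rw [hq, MvPolynomial.derivative_line, MvPolynomial.eval_line] at h1
      have h2 : Function.update a j (-δ) = a := Function.update_eq_self j a
      rw [h2] at h1
      rw [MvPolynomial.barrier, h1, hq, MvPolynomial.eval_line, h2]
    have hqδ : 0 < q.eval (-δ) := by
      rw [hq, MvPolynomial.eval_line]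
      exact hpos _ fun i => by
        rcases eq_or_ne i j with rfl | hi
        · simp
        · simp [hi, ha]
    have hxδ : 0 < x - δ := by linarith
    rw [hbar, div_le_div_iff₀ hqδ hxδ]
    -- otherwise the affine function `q` vanishes at a point `t` where it must not
    by_contra! hlt
    have hm0 : 0 < m := by
      by_contra! hm0
      nlinarith [mul_pos hα0 hqδ]
    set t := -δ - q.eval (-δ) / m with ht
    have hqt : q.eval t = 0 := by
      have e := hline (-δ)
      rw [hline t, ht]
      field_simp
      rw [e]
      ring
    rw [hq, MvPolynomial.eval_line] at hqt
    refine hne _ j (fun i hi => by simp [hi, ha]) ?_ hqt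
    rw [Function.update_self, ht]
    have : q.eval (-δ) / m * α < x - δ := by
      rw [div_mul_eq_mul_div, div_lt_iff₀ hm0]
      linarith
    linarith

end Pencil

/-! ### The theorem of Marcus, Spielman and Srivastava -/

section Selection
variable {σ κ : Type*} [Fintype σ] [DecidableEq σ] [Fintype κ]

/-- The expectation of `Q c` for a random colouring `c` with independent colours, the colour of `i`
having law `w i`. -/
noncomputable def averagePoly (Q : (σ → κ) → ℝ[X]) (w : σ → κ → ℝ) : ℝ[X] :=
  ∑ c : σ → κ, C (∏ i, w i (c i)) * Q c

omit [Fintype κ] in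
lemma prod_update_apply (w : σ → κ → ℝ) (i : σ) (u : κ → ℝ) (c : σ → κ) :
    ∏ j, Function.update w i u j (c j) = u (c i) * ∏ j ∈ Finset.univ.erase i, w j (c j) := by
  rw [← Finset.mul_prod_erase _ _ (Finset.mem_univ i), Function.update_self]
  congr 1
  exact Finset.prod_congr rfl fun j hj => by
    rw [Function.update_of_ne (Finset.ne_of_mem_erase hj)]

lemma averagePoly_eq_sum_update [DecidableEq κ] (Q : (σ → κ) → ℝ[X]) (w : σ → κ → ℝ) (i : σ) :
    averagePoly Q w
      = ∑ k, C (w i k) * averagePoly Q (Function.update w i (Pi.single k 1)) := by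
  simp only [averagePoly, prod_update_apply, Finset.mul_sum]
  rw [Finset.sum_comm]
  refine Finset.sum_congr rfl fun c _ => ?_
  rw [Finset.sum_eq_single (c i)]
  · rw [Pi.single_eq_same, one_mul, ← Finset.mul_prod_erase _ _ (Finset.mem_univ i), C_mul, mul_assoc]
  · intro k _ hk
    rw [Pi.single_eq_of_ne hk.symm]
    simp
  · simp

/-- Averages are affine in the law of each single colour. -/
lemma averagePoly_segment (Q : (σ → κ) → ℝ[X]) (w : σ → κ → ℝ) (i : σ) (u : κ → ℝ) (t : ℝ) :
    C (1 - t) * averagePoly Q w + C t * averagePoly Q (Function.update w i u)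
      = averagePoly Q (Function.update w i ((1 - t) • w i + t • u)) := by
  conv_lhs => rw [← Function.update_eq_self i w, Function.update_idem]
  simp only [averagePoly, prod_update_apply, Finset.mul_sum]
  rw [← Finset.sum_add_distrib]
  refine Finset.sum_congr rfl fun c _ => ?_
  simp only [Pi.add_apply, Pi.smul_apply, smul_eq_mul, map_mul, map_add]
  ring

lemma sum_prod_eq_one {w : σ → κ → ℝ} (hw : ∀ i, w i ∈ stdSimplex ℝ κ) :
    ∑ c : σ → κ, ∏ i, w i (c i) = 1 := by
  rw [← Fintype.prod_sum, Finset.prod_congr rfl fun i _ => (hw i).2, Finset.prod_const_one]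

lemma averagePoly_monic {Q : (σ → κ) → ℝ[X]} {n : ℕ} (hQ : ∀ c, (Q c).Monic)
    (hn : ∀ c, (Q c).natDegree = n) {w : σ → κ → ℝ} (hw : ∀ i, w i ∈ stdSimplex ℝ κ) :
    (averagePoly Q w).Monic ∧ (averagePoly Q w).natDegree = n := by
  have hle : (averagePoly Q w).natDegree ≤ n := natDegree_sum_le_of_forall_le _ _ fun c _ =>
    (natDegree_C_mul_le _ _).trans (hn c).le
  have hc : (averagePoly Q w).coeff n = 1 := by
    rw [averagePoly, finsetSum_coeff, ← sum_prod_eq_one hw]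
    refine Finset.sum_congr rfl fun c _ => ?_
    rw [coeff_C_mul, ← hn c, (hQ c).coeff_natDegree, mul_one]
  exact ⟨monic_of_natDegree_le_of_coeff_eq_one n hle hc,
    le_antisymm hle (le_natDegree_of_ne_zero (by rw [hc]; exact one_ne_zero))⟩

/-- Interlacing families: if all averages with independent colours are real-rooted and one average
is positive on `[R, ∞)`, then so is one of the averaged polynomials. The colours are fixed one
after the other. -/
lemma exists_pos_of_averagePoly_pos [DecidableEq κ] {Q : (σ → κ) → ℝ[X]} {n : ℕ} {R : ℝ}
    (hQ : ∀ c, (Q c).Monic) (hn : ∀ c, (Q c).natDegree = n)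
    (hs : ∀ w : σ → κ → ℝ, (∀ i, w i ∈ stdSimplex ℝ κ) → (averagePoly Q w).Splits)
    {w : σ → κ → ℝ} (hw : ∀ i, w i ∈ stdSimplex ℝ κ)
    (hpos : ∀ x, R ≤ x → 0 < (averagePoly Q w).eval x) :
    ∃ c, ∀ x, R ≤ x → 0 < (Q c).eval x := by
  -- the colours in `s` are deterministic under the laws `u`
  have key : ∀ s : Finset σ, ∃ u : σ → κ → ℝ, (∀ i, u i ∈ stdSimplex ℝ κ) ∧
      (∀ i ∈ s, ∃ k, u i = Pi.single k 1) ∧ ∀ x, R ≤ x → 0 < (averagePoly Q u).eval x := by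
    intro s
    induction s using Finset.induction_on with
    | empty => exact ⟨w, hw, by simp, hpos⟩
    | insert i s hi ih =>
      obtain ⟨u, hu, hus, hup⟩ := ih
      have hsingle : ∀ k j, Function.update u i (Pi.single k 1) j ∈ stdSimplex ℝ κ := fun k j => by
        rcases eq_or_ne j i with rfl | hj
        · rw [Function.update_self]; exact single_mem_stdSimplex ℝ k
        · rw [Function.update_of_ne hj]; exact hu j
      have hR := hup R le_rfl
      rw [averagePoly_eq_sum_update Q u i, eval_finsetSum] at hR
      obtain ⟨k, -, hk⟩ := Finset.exists_lt_of_sum_lt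
        (f := fun _ => (0 : ℝ)) (s := Finset.univ) (by simpa using hR)
      refine ⟨Function.update u i (Pi.single k 1), hsingle k, fun j hj => ?_, fun x hx => ?_⟩
      · rcases eq_or_ne j i with rfl | hji
        · exact ⟨k, Function.update_self ..⟩
        · rw [Function.update_of_ne hji]
          exact hus j ((Finset.mem_insert.mp hj).resolve_left hji)
      · refine eval_pos_of_segment (averagePoly_monic hQ hn hu).1
          (averagePoly_monic hQ hn (hsingle k)).1 (averagePoly_monic hQ hn hu).2
          (averagePoly_monic hQ hn (hsingle k)).2 (fun t ht => ?_) hup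
          (pos_of_mul_pos_right hk ((hu i).1 k)) hx
        rw [averagePoly_segment]
        refine hs _ fun j => ?_
        rcases eq_or_ne j i with rfl | hj
        · rw [Function.update_self]
          exact convex_stdSimplex ℝ κ (hu j) (single_mem_stdSimplex ℝ k) (by linarith [ht.2]) ht.1
            (by ring)
        · rw [Function.update_of_ne hj]; exact hu j
  obtain ⟨u, -, hus, hup⟩ := key Finset.univ
  choose c hc using fun i => hus i (Finset.mem_univ i)
  have e : averagePoly Q u = Q c := by
    rw [averagePoly, Finset.sum_eq_single c]
    · simp [hc]
    · intro d _ hd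
      obtain ⟨i, hi⟩ := Function.ne_iff.mp hd
      rw [Finset.prod_eq_zero (Finset.mem_univ i) (by rw [hc, Pi.single_eq_of_ne hi]), C_0, zero_mul]
    · simp
  exact ⟨c, fun x hx => e ▸ hup x hx⟩

end Selection

section Power
variable {σ : Type*}

lemma MvPolynomial.StableAbove.pow {p : MvPolynomial σ ℝ} {a : σ → ℝ} (hp : p.StableAbove a)
    (r : ℕ) : (p ^ r).StableAbove a :=
  ⟨fun z hz => by
    rw [map_pow, map_pow]
    exact pow_ne_zero _ (hp.isStable z hz), fun b hb => by
    rw [map_pow]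
    exact pow_pos (hp.pos b hb) r⟩

lemma MvPolynomial.barrier_pow (p : MvPolynomial σ ℝ) (b : σ → ℝ) (hb : MvPolynomial.eval b p ≠ 0)
    (j : σ) (r : ℕ) : (p ^ r).barrier j b = r * p.barrier j b := by
  rcases r with _ | r
  · simp [MvPolynomial.barrier]
  · simp only [MvPolynomial.barrier, MvPolynomial.pderiv_pow, map_mul, map_pow, map_natCast,
      Nat.add_sub_cancel]
    field_simp
    ring

end Power

section Coloring
variable {σ : Type*} [Fintype σ] [DecidableEq σ] {A : Matrix σ σ ℂ} {r : ℕ}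

/-- The compression of `r A` to the `k`-th colour class of `c`. -/
noncomputable def colorCompression (A : Matrix σ σ ℂ) (c : σ → Fin r) (k : Fin r) :
    Matrix σ σ ℂ :=
  (r : ℂ) • (Matrix.diagonal (fun i => if c i = k then (1 : ℂ) else 0) * A *
    Matrix.diagonal (fun i => if c i = k then (1 : ℂ) else 0))

lemma isHermitian_colorCompression (hA : A.IsHermitian) (c : σ → Fin r) (k : Fin r) :
    (colorCompression A c k).IsHermitian := by
  have hD : (Matrix.diagonal (fun i => if c i = k then (1 : ℂ) else 0))ᴴ
      = Matrix.diagonal (fun i => if c i = k then (1 : ℂ) else 0) := by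
    rw [Matrix.diagonal_conjTranspose]
    congr 1
    funext i
    simp [apply_ite]
  rw [Matrix.IsHermitian, colorCompression, conjTranspose_smul, conjTranspose_mul,
    conjTranspose_mul, hD, hA.eq, Matrix.mul_assoc]
  simp

lemma eval_charpoly_colorCompression (c : σ → Fin r) (k : Fin r) (x : ℂ) :
    (colorCompression A c k).charpoly.eval x
      = pencilDet A x (fun i => if c i = k then -(r : ℂ) else 0) := by
  rw [pencilDet_eq_eval_charpoly, colorCompression, ← Matrix.smul_mul, Matrix.charpoly_mul_comm,
    Matrix.mul_smul, ← Matrix.mul_assoc, Matrix.diagonal_mul_diagonal]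
  congr 2
  ext i j
  rw [Matrix.smul_apply, Matrix.diagonal_mul, Matrix.neg_mul, Matrix.neg_apply, Matrix.diagonal_mul]
  by_cases hi : c i = k <;> simp [hi]

/-- The product of the characteristic polynomials of the compressions of `r A` to the colour
classes of `c`, as a real polynomial. -/
noncomputable def colorCharpoly (hA : A.IsHermitian) (c : σ → Fin r) : ℝ[X] :=
  ∏ k, ∏ i, (X - C ((isHermitian_colorCompression hA c k).eigenvalues i))

lemma monic_colorCharpoly (hA : A.IsHermitian) (c : σ → Fin r) : (colorCharpoly hA c).Monic :=
  monic_prod_of_monic _ _ fun _ _ => monic_prod_of_monic _ _ fun _ _ => monic_X_sub_C _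

lemma natDegree_colorCharpoly (hA : A.IsHermitian) (c : σ → Fin r) :
    (colorCharpoly hA c).natDegree = r * Fintype.card σ := by
  rw [colorCharpoly, natDegree_prod_of_monic _ _ fun _ _ =>
    monic_prod_of_monic _ _ fun _ _ => monic_X_sub_C _]
  simp

lemma eval_map_colorCharpoly (hA : A.IsHermitian) (c : σ → Fin r) (z : ℂ) :
    ((colorCharpoly hA c).map (algebraMap ℝ ℂ)).eval z
      = ∏ k, pencilDet A z (fun i => if c i = k then -(r : ℂ) else 0) := by
  rw [colorCharpoly, Polynomial.map_prod, eval_prod]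
  refine Finset.prod_congr rfl fun k _ => ?_
  rw [← eval_charpoly_colorCompression, (isHermitian_colorCompression hA c k).charpoly_eq,
    Polynomial.map_prod]
  simp

lemma eval_map_averagePoly (hA : A.IsHermitian) {w : σ → Fin r → ℝ}
    (hw : ∀ i, w i ∈ stdSimplex ℝ (Fin r)) (z : ℂ) :
    ((averagePoly (colorCharpoly hA) w).map (algebraMap ℝ ℂ)).eval z
      = MvPolynomial.eval 0 (oneSubPDerivs Finset.univ.toList
        (colorPoly A z fun i k => (r : ℂ) * (w i k : ℂ))) := by
  rw [eval_zero_oneSubPDerivs_colorPoly A z r (fun i k => (w i k : ℂ)) fun i => by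
    rw [← Complex.ofReal_sum, (hw i).2, Complex.ofReal_one]]
  rw [averagePoly, Polynomial.map_sum, eval_finsetSum]
  refine Finset.sum_congr rfl fun c _ => ?_
  rw [Polynomial.map_mul, eval_mul, eval_map_colorCharpoly, map_C, eval_C]
  simp

/-- The averages are real-rooted: for `z` in the upper half-plane `colorPoly A z` is stable above some
negative height, and the operators `1 - ∂ᵢ` preserve this, so that the value at `0` is nonzero. -/
lemma splits_averagePoly_colorCharpoly (hA : A.PosSemidef) (hA1 : (1 - A).PosSemidef) (hr : 0 < r)
    {w : σ → Fin r → ℝ} (hw : ∀ i, w i ∈ stdSimplex ℝ (Fin r)) :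
    (averagePoly (colorCharpoly hA.isHermitian) w).Splits := by
  refine splits_of_eval_ne_zero_of_im_pos fun z hz => ?_
  have hr' : (0 : ℝ) < r := by exact_mod_cast hr
  rw [eval_map_averagePoly hA.isHermitian hw]
  have hst : (colorPoly A z fun i k => (r : ℂ) * (w i k : ℂ)).IsStable (-(z.im / r)) := by
    intro t ht
    rw [eval_colorPoly]
    refine Finset.prod_ne_zero_iff.mpr fun k _ => pencilDet_ne_zero_of_im_pos hA hA1 hz fun i => ?_
    have e : ((r : ℂ) * (w i k : ℂ) * t i).im = w i k * (r * (t i).im) := by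
      have : (r : ℂ) * (w i k : ℂ) = ((w i k * r : ℝ) : ℂ) := by push_cast; ring
      rw [this, Complex.im_ofReal_mul, mul_assoc]
    have h1 : -z.im < r * (t i).im := by
      have := mul_lt_mul_of_pos_left (ht i) hr'
      rwa [mul_neg, mul_div_cancel₀ _ hr'.ne'] at this
    have h0 : 0 ≤ w i k := (hw i).1 k
    have hle : w i k ≤ 1 := by
      rw [← (hw i).2]
      exact Finset.single_le_sum (fun k _ => (hw i).1 k) (Finset.mem_univ k)
    rw [e]
    rcases le_or_gt 0 (r * (t i).im) with h | h
    · linarith [mul_nonneg h0 h]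
    · nlinarith
  exact hst.oneSubPDerivs _ 0 fun j => by simpa using div_pos hz hr'

/-- The barrier argument: the expected product of characteristic polynomials for a uniformly random
colouring has no root above `(1 + √ε)²`, where `ε = r α`. -/
lemma averagePoly_uniform_pos (hA : A.PosSemidef) (hA1 : (1 - A).PosSemidef) (hr : 0 < r) {α : ℝ}
    (hα0 : 0 < α) (hα : ∀ i, (A i i).re ≤ α) {x : ℝ} (hx : (1 + √(r * α)) ^ 2 ≤ x) :
    0 < (averagePoly (colorCharpoly hA.isHermitian) fun _ (_ : Fin r) => (r : ℝ)⁻¹).eval x := by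
  have hr' : (0 : ℝ) < r := by exact_mod_cast hr
  set ρ := √(r * α) with hρ
  have hρ0 : 0 < ρ := Real.sqrt_pos.mpr (mul_pos hr' hα0)
  have hρ2 : ρ ^ 2 = r * α := Real.sq_sqrt (by positivity)
  have hδ : 0 < 1 + ρ := by linarith
  have hxδ : ρ + ρ ^ 2 ≤ x - (1 + ρ) := by nlinarith
  obtain ⟨p, hp, hst, hbar⟩ := exists_stableAbove_pencilDet hA hA1 hδ.le
    (x := x) (by nlinarith) hα0 hα
  have hpos := eval_zero_oneSubPDerivs_pos hδ (hst.pow r) fun j => by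
    rw [MvPolynomial.barrier_pow _ _ (hst.pos _ le_rfl).ne']
    calc (r : ℝ) * p.barrier j (fun _ => -(1 + ρ)) ≤ r * (α / (x - (1 + ρ))) :=
          mul_le_mul_of_nonneg_left (hbar j) hr'.le
      _ = ρ ^ 2 / (x - (1 + ρ)) := by rw [hρ2]; ring
      _ ≤ ρ ^ 2 / (ρ + ρ ^ 2) :=
          div_le_div_of_nonneg_left (by positivity) (by positivity) hxδ
      _ = 1 - 1 / (1 + ρ) := by field_simp; ring
  have hw : ∀ _ : σ, (fun _ : Fin r => (r : ℝ)⁻¹) ∈ stdSimplex ℝ (Fin r) := fun _ =>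
    ⟨fun _ => by positivity, by simp [hr'.ne']⟩
  have h1 := eval_map_averagePoly hA.isHermitian hw (x : ℂ)
  have h2 : (colorPoly A (x : ℂ) fun (_ : σ) (_ : Fin r) => (r : ℂ) * (((r : ℝ)⁻¹ : ℝ) : ℂ))
      = MvPolynomial.map (algebraMap ℝ ℂ) (p ^ r) := by
    refine MvPolynomial.funext fun z => ?_
    have hrc : (r : ℂ) ≠ 0 := by exact_mod_cast hr.ne'
    rw [eval_colorPoly, map_pow, map_pow, hp]
    simp [hrc]
  have h3 := eval_ofReal_map (oneSubPDerivs Finset.univ.toList (p ^ r)) 0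
  rw [map_oneSubPDerivs] at h3
  have h4 : (fun i => (((0 : σ → ℝ) i : ℝ) : ℂ)) = 0 := by funext i; simp
  rw [h4] at h3
  rw [h2, eval_map_ofReal_ofReal, h3] at h1
  rw [Complex.ofReal_inj.mp h1]
  exact hpos

/-- A Hermitian matrix whose characteristic polynomial has no real root in `[R, ∞)` is at most
`R`. -/
lemma re_dotProduct_le_of_charpoly_ne_zero {B : Matrix σ σ ℂ} (hB : B.IsHermitian) {R : ℝ}
    (h : ∀ x : ℝ, R ≤ x → B.charpoly.eval (x : ℂ) ≠ 0) (v : σ → ℂ) :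
    (star v ⬝ᵥ B *ᵥ v).re ≤ R * ∑ i, ‖v i‖ ^ 2 := by
  have hH : ((R : ℂ) • (1 : Matrix σ σ ℂ) - B).IsHermitian := by
    refine IsHermitian.sub ?_ hB
    rw [Matrix.IsHermitian, conjTranspose_smul, conjTranspose_one, Complex.star_def,
      Complex.conj_ofReal]
  have hpsd : ((R : ℂ) • (1 : Matrix σ σ ℂ) - B).PosSemidef := by
    rw [hH.posSemidef_iff_eigenvalues_nonneg]
    intro i
    -- a negative eigenvalue `μ` of `R - B` gives the root `R - μ ≥ R` of `B.charpoly`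
    by_contra! hneg
    have hneg : hH.eigenvalues i < 0 := hneg
    have hroot : ((R : ℂ) • (1 : Matrix σ σ ℂ) - B).charpoly.eval (hH.eigenvalues i : ℂ) = 0 := by
      rw [hH.charpoly_eq, eval_prod]
      exact Finset.prod_eq_zero (Finset.mem_univ i) (by simp)
    refine h (R - hH.eigenvalues i) (by linarith) ?_
    rw [Matrix.eval_charpoly] at hroot ⊢
    have e : Matrix.scalar σ (((R - hH.eigenvalues i : ℝ)) : ℂ) - B
        = -(Matrix.scalar σ (hH.eigenvalues i : ℂ) - ((R : ℂ) • (1 : Matrix σ σ ℂ) - B)) := by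
      rw [Matrix.scalar_apply, Matrix.scalar_apply, ← Matrix.smul_one_eq_diagonal,
        ← Matrix.smul_one_eq_diagonal, Complex.ofReal_sub, sub_smul]
      abel
    rw [e, Matrix.det_neg, hroot, mul_zero]
  have h1 := (Complex.le_def.mp (hpsd.dotProduct_mulVec_nonneg v)).1
  rw [sub_mulVec, smul_mulVec, one_mulVec, dotProduct_sub, dotProduct_smul, smul_eq_mul,
    Complex.sub_re, Complex.re_ofReal_mul, re_star_dotProduct_self, Complex.zero_re] at h1
  linarith

/-- The theorem of Marcus, Spielman and Srivastava, in the form of a partition of the index set of a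
positive contraction with small diagonal entries. -/
theorem exists_coloring_re_dotProduct_le (hA : A.PosSemidef) (hA1 : (1 - A).PosSemidef) {α : ℝ}
    (hα0 : 0 < α) (hα : ∀ i, (A i i).re ≤ α) (hr : 0 < r) :
    ∃ c : σ → Fin r, ∀ (k : Fin r) (v : σ → ℂ), (∀ i, c i ≠ k → v i = 0) →
      (star v ⬝ᵥ A *ᵥ v).re ≤ (1 + √(r * α)) ^ 2 / r * ∑ i, ‖v i‖ ^ 2 := by
  have hr' : (0 : ℝ) < r := by exact_mod_cast hr
  obtain ⟨c, hc⟩ := exists_pos_of_averagePoly_pos (monic_colorCharpoly hA.isHermitian)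
    (natDegree_colorCharpoly hA.isHermitian)
    (fun w hw => splits_averagePoly_colorCharpoly hA hA1 hr hw)
    (fun _ => ⟨fun _ => by positivity, by simp [hr'.ne']⟩)
    (fun x hx => averagePoly_uniform_pos hA hA1 hr hα0 hα hx)
  refine ⟨c, fun k v hv => ?_⟩
  have h := re_dotProduct_le_of_charpoly_ne_zero (isHermitian_colorCompression hA.isHermitian c k)
    (R := (1 + √(r * α)) ^ 2) (fun x hx h0 => by
      have h1 := eval_map_colorCharpoly hA.isHermitian c (x : ℂ)
      rw [Finset.prod_eq_zero (Finset.mem_univ k) (by rw [← eval_charpoly_colorCompression, h0]),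
        eval_map_ofReal_ofReal] at h1
      exact (hc x hx).ne' (Complex.ofReal_eq_zero.mp h1)) v
  set D := Matrix.diagonal (fun i => if c i = k then (1 : ℂ) else 0) with hD
  have hDv : D *ᵥ v = v := by
    funext i
    rw [hD, mulVec_diagonal]
    by_cases hi : c i = k
    · simp [hi]
    · simp [hi, hv i hi]
  have hvD : star v ᵥ* D = star v := by
    funext i
    rw [hD, vecMul_diagonal, Pi.star_apply]
    by_cases hi : c i = k
    · simp [hi]
    · simp [hi, hv i hi]
  have e : star v ⬝ᵥ colorCompression A c k *ᵥ v = ((r : ℝ) : ℂ) * (star v ⬝ᵥ A *ᵥ v) := by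
    rw [colorCompression, ← hD, smul_mulVec, dotProduct_smul, ← mulVec_mulVec, hDv,
      ← mulVec_mulVec, dotProduct_mulVec, hvD, smul_eq_mul, Complex.ofReal_natCast]
  rw [e, Complex.re_ofReal_mul] at h
  rw [div_mul_eq_mul_div, le_div_iff₀ hr']
  linarith

end Coloring

/-! ### Paving -/

section Paving

/-- The `N × N` corner of the matrix of an operator on `ℓ²(ℕ)`. -/
noncomputable def cornerMatrix (T : BoundedOps) (N : ℕ) : Matrix (Fin N) (Fin N) ℂ :=
  Matrix.of fun i j => inner ℂ (lp.single 2 (i : ℕ) (1 : ℂ) : HilbertL2) (T (lp.single 2 (j : ℕ) (1 : ℂ)))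

lemma inner_map_sum_single (T : BoundedOps) {N : ℕ} (w : Fin N → ℂ) :
    inner ℂ (∑ i : Fin N, (lp.single 2 (i : ℕ) (w i) : HilbertL2))
      (T (∑ i : Fin N, lp.single 2 (i : ℕ) (w i))) = star w ⬝ᵥ cornerMatrix T N *ᵥ w := by
  have h : ∀ i : Fin N, (lp.single 2 (i : ℕ) (w i) : HilbertL2) = w i • lp.single 2 (i : ℕ) (1 : ℂ) :=
    fun i => by rw [← lp.single_smul, smul_eq_mul, mul_one]
  simp only [h, map_sum, map_smul, sum_inner, inner_sum, inner_smul_left, inner_smul_right,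
    dotProduct, mulVec, cornerMatrix, Matrix.of_apply, Finset.mul_sum, Pi.star_apply,
    Complex.star_def]
  rw [Finset.sum_comm]
  exact Finset.sum_congr rfl fun i _ => Finset.sum_congr rfl fun j _ => by ring

lemma cornerMatrix_one (N : ℕ) : cornerMatrix 1 N = 1 := by
  ext i j
  rw [cornerMatrix, Matrix.of_apply, one_apply_eq_self, lp.inner_single_left,
    lp.single_apply, Matrix.one_apply, Pi.single_apply]
  by_cases h : i = j
  · simp [h]
  · simp [h, Fin.val_inj]

lemma norm_sq_sum_single {N : ℕ} (w : Fin N → ℂ) :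
    ‖∑ i : Fin N, (lp.single 2 (i : ℕ) (w i) : HilbertL2)‖ ^ 2 = ∑ i, ‖w i‖ ^ 2 := by
  have h := inner_map_sum_single 1 w
  rw [cornerMatrix_one, one_mulVec, one_apply_eq_self] at h
  rw [← re_star_dotProduct_self, ← h]
  exact norm_sq_eq_re_inner (𝕜 := ℂ) _

lemma isHermitian_cornerMatrix {T : BoundedOps} (hT : IsSelfAdjoint T) (N : ℕ) :
    (cornerMatrix T N).IsHermitian := by
  ext i j
  rw [conjTranspose_apply, cornerMatrix, Matrix.of_apply, Matrix.of_apply, Complex.star_def,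
    inner_conj_symm]
  exact (ContinuousLinearMap.isSelfAdjoint_iff_isSymmetric.mp hT) _ _

lemma abs_re_inner_le {T : BoundedOps} (hT1 : ‖T‖ ≤ 1) (v : HilbertL2) :
    |(inner ℂ v (T v)).re| ≤ ‖v‖ ^ 2 := by
  refine (Complex.abs_re_le_norm _).trans ((norm_inner_le_norm _ _).trans ?_)
  rw [sq]
  exact mul_le_mul_of_nonneg_left ((T.le_opNorm v).trans
    (mul_le_of_le_one_left (norm_nonneg _) hT1)) (norm_nonneg _)

lemma posSemidef_half_one_add_cornerMatrix {T : BoundedOps} (hT : IsSelfAdjoint T) (hT1 : ‖T‖ ≤ 1)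
    (N : ℕ) : ((1 / 2 : ℂ) • (1 + cornerMatrix T N)).PosSemidef := by
  have hH := isHermitian_cornerMatrix hT N
  have hH' : ((1 / 2 : ℂ) • (1 + cornerMatrix T N)).IsHermitian := by
    rw [Matrix.IsHermitian, conjTranspose_smul, (Matrix.isHermitian_one.add hH).eq]
    simp
  refine PosSemidef.of_dotProduct_mulVec_nonneg hH' fun w => ?_
  have him : (star w ⬝ᵥ ((1 / 2 : ℂ) • (1 + cornerMatrix T N)) *ᵥ w).im = 0 :=
    hH'.im_star_dotProduct_mulVec_self w
  rw [Complex.nonneg_iff]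
  refine ⟨?_, him.symm⟩
  rw [smul_mulVec, add_mulVec, one_mulVec, dotProduct_smul, dotProduct_add, ← inner_map_sum_single,
    smul_eq_mul]
  have e : (1 / 2 : ℂ) = ((1 / 2 : ℝ) : ℂ) := by simp
  rw [e, Complex.re_ofReal_mul, Complex.add_re, re_star_dotProduct_self, ← norm_sq_sum_single]
  have := (abs_le.mp (abs_re_inner_le hT1 (∑ i : Fin N, (lp.single 2 (i : ℕ) (w i) : HilbertL2)))).1
  linarith

lemma eq_sum_single_of_support {N : ℕ} {v : HilbertL2} (hv : ∀ n, N ≤ n → v n = 0) :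
    v = ∑ i : Fin N, (lp.single 2 (i : ℕ) (v i) : HilbertL2) := by
  rw [Fin.sum_univ_eq_sum_range (fun n => (lp.single 2 n (v n) : HilbertL2)) N]
  ext n
  rw [lp.coeFn_sum, Finset.sum_apply]
  simp only [lp.single_apply, Finset.sum_pi_single]
  by_cases h : n < N
  · simp [h]
  · simp [h, hv n (not_lt.mp h)]

/-- One-sided paving of the corners of a zero-diagonal self-adjoint contraction, with a number of
colours that depends only on `ε`. -/
lemma exists_paving_corner {ε : ℝ} (hε : 0 < ε) : ∃ r : ℕ, 0 < r ∧ ∀ (T : BoundedOps),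
    IsSelfAdjoint T → ‖T‖ ≤ 1 →
    (∀ n, inner ℂ (lp.single 2 n (1 : ℂ) : HilbertL2) (T (lp.single 2 n (1 : ℂ))) = 0) →
    ∀ N : ℕ, ∃ c : ℕ → Fin r, ∀ (k : Fin r) (v : HilbertL2), (∀ n, N ≤ n → v n = 0) →
      (∀ n, c n ≠ k → v n = 0) → (inner ℂ v (T v)).re ≤ ε * ‖v‖ ^ 2 := by
  obtain ⟨m, hm⟩ := exists_nat_gt (3 / ε)
  have hm0 : (0 : ℝ) < m := (by positivity : 0 < 3 / ε).trans hm
  have hm1 : 0 < m := by exact_mod_cast hm0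
  have hr : 0 < 2 * m ^ 2 := by positivity
  -- with `r = 2 m²` the bound `2 (1 + √(r / 2))² / r - 1` equals `2 / m + 1 / m²`
  refine ⟨2 * m ^ 2, hr, fun T hT hT1 hdiag N => ?_⟩
  set M := cornerMatrix T N with hM
  have hneg : cornerMatrix (-T) N = -M := by
    ext i j
    simp [hM, cornerMatrix]
  have hA := posSemidef_half_one_add_cornerMatrix hT hT1 N
  have hA1 : (1 - (1 / 2 : ℂ) • (1 + M)).PosSemidef := by
    have h := posSemidef_half_one_add_cornerMatrix hT.neg (by rwa [norm_neg]) N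
    rw [hneg] at h
    convert h using 1
    rw [smul_add, smul_add, smul_neg]
    nth_rewrite 1 [← one_smul ℂ (1 : Matrix (Fin N) (Fin N) ℂ)]
    rw [← sub_sub, ← sub_smul, sub_eq_add_neg]
    norm_num
  obtain ⟨c, hc⟩ := exists_coloring_re_dotProduct_le hA hA1 (α := 1 / 2) (by norm_num)
    (fun i => by
      have : cornerMatrix T N i i = 0 := hdiag i
      simp [this]) hr
  refine ⟨fun n => if h : n < N then c ⟨n, h⟩ else ⟨0, hr⟩, fun k v hvN hvk => ?_⟩
  have h := hc k (fun i => v i) fun i hi => hvk i (by simpa using hi)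
  have hv := eq_sum_single_of_support hvN
  rw [smul_mulVec, add_mulVec, one_mulVec, dotProduct_smul, dotProduct_add, ← inner_map_sum_single,
    smul_eq_mul, ← hv] at h
  have e : (1 / 2 : ℂ) = ((1 / 2 : ℝ) : ℂ) := by simp
  rw [e, Complex.re_ofReal_mul, Complex.add_re, re_star_dotProduct_self, ← norm_sq_sum_single,
    ← hv] at h
  have hsqrt : √(((2 * m ^ 2 : ℕ) : ℝ) * (1 / 2)) = m := by
    rw [show ((2 * m ^ 2 : ℕ) : ℝ) * (1 / 2) = (m : ℝ) ^ 2 by push_cast; ring]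
    exact Real.sqrt_sq hm0.le
  rw [hsqrt] at h
  have hb : 2 * ((1 + (m : ℝ)) ^ 2 / ((2 * m ^ 2 : ℕ) : ℝ)) - 1 ≤ ε := by
    have hm1' : (1 : ℝ) ≤ m := by exact_mod_cast hm1
    have e1 : 2 * ((1 + (m : ℝ)) ^ 2 / ((2 * m ^ 2 : ℕ) : ℝ)) - 1 = (1 + 2 * m) / m ^ 2 := by
      push_cast
      field_simp
      ring
    rw [e1, div_le_iff₀ (by positivity)]
    rw [div_lt_iff₀ hε] at hm
    nlinarith
  have hv0 : 0 ≤ ‖v‖ ^ 2 := by positivity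
  nlinarith [mul_le_mul_of_nonneg_right hb hv0]

/-- One-sided paving of zero-diagonal self-adjoint contractions of `ℓ²(ℕ)`; the colouring is an
ultrafilter limit of colourings for the corners. -/
theorem exists_paving {ε : ℝ} (hε : 0 < ε) {T : BoundedOps} (hT : IsSelfAdjoint T) (hT1 : ‖T‖ ≤ 1)
    (hdiag : ∀ n, inner ℂ (lp.single 2 n (1 : ℂ) : HilbertL2) (T (lp.single 2 n (1 : ℂ))) = 0) :
    ∃ (r : ℕ) (c : ℕ → Fin r), ∀ (k : Fin r) (v : HilbertL2), (∀ n, c n ≠ k → v n = 0) →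
      (inner ℂ v (T v)).re ≤ ε * ‖v‖ ^ 2 := by
  obtain ⟨r, hr, h⟩ := exists_paving_corner hε
  choose C hC using h T hT hT1 hdiag
  set U := Filter.hyperfilter ℕ
  have hlim : ∀ n, ∃ k, ∀ᶠ N in (U : Filter ℕ), C N n = k := fun n => by
    obtain ⟨k, hk⟩ := (U.map fun N => C N n).eq_pure_of_finite
    refine ⟨k, ?_⟩
    have h1 : {k} ∈ U.map fun N => C N n := by rw [hk]; exact Filter.mem_pure.mpr rfl
    exact h1
  choose c hc using hlim
  refine ⟨r, c, fun k v hv => ?_⟩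
  have hfin : ∀ (M : ℕ) (u : HilbertL2), (∀ n, M ≤ n → u n = 0) → (∀ n, c n ≠ k → u n = 0) →
      (inner ℂ u (T u)).re ≤ ε * ‖u‖ ^ 2 := fun M u huM huk => by
    have h1 : ∀ᶠ N in (U : Filter ℕ), ∀ n ∈ Finset.range M, C N n = c n :=
      (Finset.eventually_all _).mpr fun n _ => hc n
    have h2 : ∀ᶠ N in (U : Filter ℕ), M ≤ N := by
      have h3 := Filter.hyperfilter_le_cofinite (α := ℕ)
      rw [Nat.cofinite_eq_atTop] at h3
      exact h3 (Filter.eventually_ge_atTop M)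
    obtain ⟨N, hN1, hN2⟩ := (h1.and h2).exists
    refine hC N k u (fun n hn => huM n (hN2.trans hn)) fun n hn => ?_
    rcases Nat.lt_or_ge n M with h | h
    · exact huk n (by rwa [← hN1 n (Finset.mem_range.mpr h)])
    · exact huM n h
  have hsum := (lp.hasSum_single (p := 2) ENNReal.ofNat_ne_top v).tendsto_sum_nat
  have hL : Continuous fun u : HilbertL2 => (inner ℂ u (T u)).re :=
    Complex.continuous_re.comp (continuous_id.inner T.continuous)
  have hR : Continuous fun u : HilbertL2 => ε * ‖u‖ ^ 2 := by fun_prop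
  refine le_of_tendsto_of_tendsto' ((hL.tendsto v).comp hsum) ((hR.tendsto v).comp hsum) fun M => ?_
  have happ : ∀ n, (∑ i ∈ Finset.range M, (lp.single 2 i (v i) : HilbertL2)) n
      = if n < M then v n else 0 := fun n => by
    rw [lp.coeFn_sum, Finset.sum_apply]
    simp only [lp.single_apply, Finset.sum_pi_single, Finset.mem_range]
  refine hfin M _ (fun n hn => ?_) fun n hn => ?_
  · rw [happ, if_neg (not_lt.mpr hn)]
  · rw [happ, hv n hn, ite_self]

end Paving

/-! ### Pure states of the diagonal algebra and their extensions -/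

section States

lemma ContinuousLinearMap.IsPositive.exists_eq_star_mul_self {H : Type*} [NormedAddCommGroup H]
    [InnerProductSpace ℂ H] [CompleteSpace H] {T : H →L[ℂ] H} (hT : T.IsPositive) :
    ∃ s : H →L[ℂ] H, T = star s * s :=
  CStarAlgebra.nonneg_iff_eq_star_mul_self.mp ((ContinuousLinearMap.nonneg_iff_isPositive T).mpr hT)

lemma apply_nonneg_of_mem_stateSpace {ψ : BoundedOps →L[ℂ] ℂ} (hψ : ψ ∈ stateSpace BoundedOps)
    {T : BoundedOps} (hT : IsSelfAdjoint T) (h : ∀ v, 0 ≤ (inner ℂ v (T v)).re) : 0 ≤ ψ T := by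
  have hpos : T.IsPositive := ContinuousLinearMap.isPositive_def'.mpr ⟨hT, fun v => by
    rw [ContinuousLinearMap.reApplyInnerSelf_apply, inner_re_symm]
    exact h v⟩
  obtain ⟨s, rfl⟩ := hpos.exists_eq_star_mul_self
  exact hψ.1 s

/-- The values of a pure state of a commutative algebra at projections are `0` and `1`: otherwise
the projection `p` decomposes the state `φ` into multiples of `φ (p ·)` and `φ ((1 - p) ·)`. -/
lemma apply_eq_zero_or_one_of_mem_pureStates {A : Type*} [Ring A] [StarRing A] [Algebra ℂ A]
    [TopologicalSpace A] [ContinuousMul A] (hcomm : ∀ x y : A, x * y = y * x) {φ : A →L[ℂ] ℂ}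
    (hφ : φ ∈ pureStates A) {p : A} (hp : star p = p) (hpp : p * p = p) : φ p = 0 ∨ φ p = 1 := by
  have hst := hφ.1
  by_contra! hne
  -- the functional `φ (q ·) / φ q` is a state for each projection `q` with `φ q ≠ 0`
  let cut : A → A →L[ℂ] ℂ := fun q =>
    ((φ q).re⁻¹ : ℝ) • φ.comp ⟨LinearMap.mulLeft ℂ q, continuous_const.mul continuous_id⟩
  have hcut : ∀ q x, cut q x = (((φ q).re⁻¹ : ℝ) : ℂ) * φ (q * x) := fun q x => by
    change ((φ q).re⁻¹ : ℝ) • φ (q * x) = _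
    rw [Complex.real_smul]
  have hre : ∀ q : A, star q = q → q * q = q → 0 ≤ (φ q).re ∧ φ q = ((φ q).re : ℂ) :=
    fun q hq hqq => by
      have h := hst.1 q
      rw [hq, hqq] at h
      exact ⟨(Complex.nonneg_iff.mp h).1, Complex.ext rfl (Complex.nonneg_iff.mp h).2.symm⟩
  have hcutst : ∀ q : A, star q = q → q * q = q → φ q ≠ 0 → cut q ∈ stateSpace A :=
    fun q hq hqq h0 => by
      obtain ⟨h1, h2⟩ := hre q hq hqq
      refine ⟨fun x => ?_, ?_⟩
      · have e : q * (star x * x) = star (q * x) * (q * x) := by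
          rw [star_mul, hq, mul_assoc, ← mul_assoc q q x, hqq, ← mul_assoc, hcomm q, mul_assoc]
        rw [hcut, e]
        exact mul_nonneg (by exact_mod_cast inv_nonneg.mpr h1) (hst.1 _)
      · rw [hcut, mul_one, Complex.ofReal_inv, ← h2, inv_mul_cancel₀ h0]
  have hq : star (1 - p) = 1 - p := by rw [star_sub, star_one, hp]
  have hqq : (1 - p) * (1 - p) = 1 - p := by
    rw [mul_sub, mul_one, sub_mul, one_mul, hpp, sub_self, sub_zero]
  have hφq : φ (1 - p) = 1 - φ p := by rw [map_sub, hst.2]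
  have hq0 : φ (1 - p) ≠ 0 := by rw [hφq]; exact sub_ne_zero.mpr hne.2.symm
  obtain ⟨h1, h2⟩ := hre p hp hpp
  obtain ⟨h3, h4⟩ := hre _ hq hqq
  have hp0 : (φ p).re ≠ 0 := fun h => hne.1 (by rw [h2, h, Complex.ofReal_zero])
  have hq0' : (φ (1 - p)).re ≠ 0 := fun h => hq0 (by rw [h4, h, Complex.ofReal_zero])
  have hseg : φ ∈ openSegment ℝ (cut p) (cut (1 - p)) := by
    refine ⟨(φ p).re, (φ (1 - p)).re, lt_of_le_of_ne h1 hp0.symm, lt_of_le_of_ne h3 hq0'.symm, ?_, ?_⟩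
    · rw [hφq]; simp
    · ext x
      simp only [_root_.add_apply, _root_.smul_apply, hcut,
        Complex.real_smul]
      rw [← mul_assoc, ← mul_assoc, ← Complex.ofReal_mul, ← Complex.ofReal_mul,
        mul_inv_cancel₀ hp0, mul_inv_cancel₀ hq0', Complex.ofReal_one, one_mul, one_mul, ← map_add,
        ← add_mul, add_sub_cancel, one_mul]
  have h5 := ((mem_extremePoints.mp hφ).2 _ (hcutst p hp hpp hne.1) _ (hcutst _ hq hqq hq0) hseg).1
  refine hne.2 ?_
  rw [← h5, hcut, hpp, Complex.ofReal_inv, ← h2, inv_mul_cancel₀ hne.1]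

end States

section Diagonal

/-- The diagonal operator of `a`, as an element of the diagonal algebra. -/
noncomputable def diagonalElement (a : ℓ^∞(ℕ, ℂ)) : diagonalAlgebra := ⟨diagonalRep a, ⟨a, rfl⟩⟩

lemma diagonalElement_mul (a b : ℓ^∞(ℕ, ℂ)) :
    diagonalElement (a * b) = diagonalElement a * diagonalElement b :=
  Subtype.ext (map_mul diagonalRep a b)

lemma diagonalElement_star (a : ℓ^∞(ℕ, ℂ)) : diagonalElement (star a) = star (diagonalElement a) :=
  Subtype.ext (map_star diagonalRep a)

lemma exists_diagonalElement_eq (x : diagonalAlgebra) : ∃ a, diagonalElement a = x := by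
  obtain ⟨T, a, rfl⟩ := x
  exact ⟨a, rfl⟩

lemma diagonalAlgebra_mul_comm (x y : diagonalAlgebra) : x * y = y * x := by
  obtain ⟨a, rfl⟩ := exists_diagonalElement_eq x
  obtain ⟨b, rfl⟩ := exists_diagonalElement_eq y
  rw [← diagonalElement_mul, ← diagonalElement_mul, mul_comm]

/-- The indicator function of `S` as a bounded sequence. -/
noncomputable def indicatorSeq (S : Set ℕ) : ℓ^∞(ℕ, ℂ) :=
  ⟨S.indicator 1, memℓp_infty ⟨1, by
    rintro _ ⟨n, rfl⟩
    by_cases h : n ∈ S <;> simp [h]⟩⟩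

lemma indicatorSeq_apply (S : Set ℕ) (n : ℕ) : indicatorSeq S n = S.indicator 1 n := rfl

lemma indicatorSeq_mul_self (S : Set ℕ) : indicatorSeq S * indicatorSeq S = indicatorSeq S := by
  ext n
  rw [lp.infty_coeFn_mul, Pi.mul_apply, indicatorSeq_apply]
  by_cases h : n ∈ S <;> simp [h]

lemma star_indicatorSeq (S : Set ℕ) : star (indicatorSeq S) = indicatorSeq S := by
  ext n
  rw [lp.star_apply, indicatorSeq_apply]
  by_cases h : n ∈ S <;> simp [h]

/-- The diagonal of an operator, as a bounded sequence. -/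
noncomputable def diagonalSeq (T : BoundedOps) : ℓ^∞(ℕ, ℂ) :=
  ⟨fun n => inner ℂ (lp.single 2 n (1 : ℂ) : HilbertL2) (T (lp.single 2 n (1 : ℂ))),
    memℓp_infty ⟨‖T‖, by
      rintro _ ⟨n, rfl⟩
      have h1 : ‖(lp.single 2 n (1 : ℂ) : HilbertL2)‖ = 1 := by
        rw [lp.norm_single (by norm_num), norm_one]
      refine (norm_inner_le_norm _ _).trans ?_
      rw [h1, one_mul]
      simpa [h1] using T.le_opNorm (lp.single 2 n (1 : ℂ) : HilbertL2)⟩⟩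

lemma diagonalSeq_apply (T : BoundedOps) (n : ℕ) : diagonalSeq T n
    = inner ℂ (lp.single 2 n (1 : ℂ) : HilbertL2) (T (lp.single 2 n (1 : ℂ))) := rfl

lemma norm_diagonalSeq_le (T : BoundedOps) : ‖diagonalSeq T‖ ≤ ‖T‖ := by
  refine lp.norm_le_of_forall_le (norm_nonneg T) fun n => ?_
  have h1 : ‖(lp.single 2 n (1 : ℂ) : HilbertL2)‖ = 1 := by
    rw [lp.norm_single (by norm_num), norm_one]
  refine (norm_inner_le_norm _ _).trans ?_
  rw [h1, one_mul]
  simpa [h1] using T.le_opNorm (lp.single 2 n (1 : ℂ) : HilbertL2)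

lemma norm_diagonalRep_le (a : ℓ^∞(ℕ, ℂ)) : ‖diagonalRep a‖ ≤ ‖a‖ := by
  change ‖diagonalOp a‖ ≤ ‖a‖
  unfold diagonalOp
  exact LinearMap.mkContinuous_norm_le _ (norm_nonneg _) _

lemma diagonalSeq_diagonalRep (a : ℓ^∞(ℕ, ℂ)) : diagonalSeq (diagonalRep a) = a := by
  ext n
  rw [diagonalSeq_apply, lp.inner_single_left]
  change inner ℂ (1 : ℂ) (a n * (lp.single 2 n (1 : ℂ) : HilbertL2) n) = a n
  simp

/-- The conditional expectation of `B(ℓ²(ℕ))` onto the diagonal algebra: it deletes the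
off-diagonal entries. -/
noncomputable def diagonalExpectation : BoundedOps →L[ℂ] diagonalAlgebra where
  toFun T := diagonalElement (diagonalSeq T)
  map_add' S T := by
    refine Subtype.ext ?_
    change diagonalRep _ = diagonalRep _ + diagonalRep _
    rw [← map_add]
    congr 1
    ext n
    simp [diagonalSeq_apply]
  map_smul' c T := by
    refine Subtype.ext ?_
    change diagonalRep _ = c • diagonalRep _
    rw [← map_smul]
    congr 1
    ext n
    simp [diagonalSeq_apply]
  cont := by
    refine Continuous.subtype_mk ?_ _
    have h : ∀ S T : BoundedOps, ‖diagonalRep (diagonalSeq S) - diagonalRep (diagonalSeq T)‖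
        ≤ 1 * ‖S - T‖ := fun S T => by
      have e : diagonalSeq S - diagonalSeq T = diagonalSeq (S - T) := by
        ext n
        simp [diagonalSeq_apply]
      rw [← map_sub, e, one_mul]
      exact (norm_diagonalRep_le _).trans (norm_diagonalSeq_le _)
    exact (LipschitzWith.of_dist_le_mul (K := 1) fun S T => by
      simpa [dist_eq_norm] using h S T).continuous

lemma diagonalExpectation_apply (T : BoundedOps) :
    diagonalExpectation T = diagonalElement (diagonalSeq T) := rfl

lemma diagonalExpectation_coe (x : diagonalAlgebra) : diagonalExpectation (x : BoundedOps) = x := by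
  obtain ⟨a, rfl⟩ := exists_diagonalElement_eq x
  rw [diagonalExpectation_apply]
  exact congrArg diagonalElement (diagonalSeq_diagonalRep a)

/-- Composition with the conditional expectation extends states of the diagonal algebra. -/
lemma comp_diagonalExpectation_mem_stateSpace {φ : diagonalAlgebra →L[ℂ] ℂ}
    (hφ : φ ∈ stateSpace diagonalAlgebra) : φ.comp diagonalExpectation ∈ stateSpace BoundedOps := by
  refine ⟨fun x => ?_, ?_⟩
  · -- the diagonal of `x* x` consists of the squares of the norms of the columns of `x`
    have hb : ∀ n, ‖x (lp.single 2 n (1 : ℂ) : HilbertL2)‖ ≤ ‖x‖ := fun n => by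
      have h := x.le_opNorm (lp.single 2 n (1 : ℂ) : HilbertL2)
      rwa [lp.norm_single (by norm_num), norm_one, mul_one] at h
    let d : ℓ^∞(ℕ, ℂ) := ⟨fun n => (‖x (lp.single 2 n (1 : ℂ) : HilbertL2)‖ : ℂ),
      memℓp_infty ⟨‖x‖, by
        rintro _ ⟨n, rfl⟩
        simpa using hb n⟩⟩
    have hd : diagonalSeq (star x * x) = star d * d := by
      ext n
      rw [diagonalSeq_apply, lp.infty_coeFn_mul, Pi.mul_apply, lp.star_apply,
        ContinuousLinearMap.star_eq_adjoint, mul_apply_eq_comp,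
        ContinuousLinearMap.adjoint_inner_right, inner_self_eq_norm_sq_to_K]
      change _ = star (‖x (lp.single 2 n (1 : ℂ) : HilbertL2)‖ : ℂ) * _
      rw [Complex.star_def, Complex.conj_ofReal, sq]
      rfl
    rw [ContinuousLinearMap.comp_apply, diagonalExpectation_apply, hd, diagonalElement_mul,
      diagonalElement_star]
    exact hφ.1 _
  · have h := diagonalExpectation_coe 1
    rw [ContinuousLinearMap.comp_apply]
    exact (congrArg φ h).trans hφ.2

end Diagonal

section Uniqueness
variable {φ : diagonalAlgebra →L[ℂ] ℂ} {ψ : BoundedOps →L[ℂ] ℂ}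

/-- Paving forces a state extending a pure state of the diagonal algebra to be nonpositive at
zero-diagonal self-adjoint operators. One projection `P` of the paving has `φ P = 1`, and `T` is
bounded by `2 ε` plus a multiple of `1 - P`. -/
lemma re_apply_nonpos_of_diagonal_eq_zero (hφ : φ ∈ pureStates diagonalAlgebra)
    (hψ : ψ ∈ stateSpace BoundedOps) (hext : ∀ T : diagonalAlgebra, ψ (T : BoundedOps) = φ T)
    {T : BoundedOps} (hT : IsSelfAdjoint T) (hT1 : ‖T‖ ≤ 1) (hdiag : diagonalSeq T = 0) :
    (ψ T).re ≤ 0 := by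
  refine le_of_forall_pos_le_add fun η hη => ?_
  set ε := η / 2 with hε
  have hε0 : 0 < ε := by positivity
  obtain ⟨r, c, hc⟩ := exists_paving hε0 hT hT1 fun n => by
    rw [← diagonalSeq_apply, hdiag]; rfl
  -- a colour class whose projection is not annihilated by `φ`
  obtain ⟨k, hk⟩ : ∃ k, φ (diagonalElement (indicatorSeq (c ⁻¹' {k}))) ≠ 0 := by
    by_contra! h
    have hsum : ∑ k, diagonalElement (indicatorSeq (c ⁻¹' {k})) = 1 := by
      refine Subtype.ext ?_
      change ((∑ k, diagonalElement (indicatorSeq (c ⁻¹' {k})) : diagonalAlgebra) : BoundedOps) = 1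
      rw [AddSubmonoidClass.coe_finsetSum]
      change ∑ k, diagonalRep (indicatorSeq (c ⁻¹' {k})) = 1
      rw [← map_sum, ← map_one diagonalRep]
      congr 1
      ext n
      rw [lp.coeFn_sum, Finset.sum_apply, lp.infty_coeFn_one]
      change ∑ k, (c ⁻¹' {k}).indicator (1 : ℕ → ℂ) n = 1
      rw [Finset.sum_eq_single (c n)]
      · exact Set.indicator_of_mem (s := c ⁻¹' {c n}) rfl 1
      · exact fun k _ hk => Set.indicator_of_notMem (fun h => hk (Eq.symm h)) 1
      · exact fun h => (h (Finset.mem_univ _)).elim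
    have h1 := congrArg φ hsum
    rw [map_sum, Finset.sum_eq_zero fun k _ => h k, hφ.1.2] at h1
    exact zero_ne_one h1
  set a := indicatorSeq (c ⁻¹' {k}) with ha
  have hφ1 : φ (diagonalElement a) = 1 :=
    (apply_eq_zero_or_one_of_mem_pureStates diagonalAlgebra_mul_comm hφ
      (by rw [← diagonalElement_star, ha, star_indicatorSeq])
      (by rw [← diagonalElement_mul, ha, indicatorSeq_mul_self])).resolve_left hk
  set P : BoundedOps := diagonalRep a with hP
  have hψP : ψ P = 1 := (hext (diagonalElement a)).trans hφ1
  have hPsa : IsSelfAdjoint P := by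
    rw [isSelfAdjoint_iff, hP, ← map_star, ha, star_indicatorSeq]
  have hPP : P * P = P := by rw [hP, ← map_mul, ha, indicatorSeq_mul_self]
  set K := 1 / ε + 1 with hK
  have hK0 : 0 < K := by positivity
  have hpos : 0 ≤ ψ (((2 * ε : ℝ) : ℂ) • (1 : BoundedOps) + ((K : ℝ) : ℂ) • (1 - P) - T) := by
    refine apply_nonneg_of_mem_stateSpace hψ ?_ fun v => ?_
    · refine IsSelfAdjoint.sub (IsSelfAdjoint.add ?_ ?_) hT
      · exact IsSelfAdjoint.smul (Complex.conj_ofReal _) (IsSelfAdjoint.one _)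
      · exact IsSelfAdjoint.smul (Complex.conj_ofReal _) ((IsSelfAdjoint.one _).sub hPsa)
    · set p := P v with hp
      set q := v - P v with hq
      have hv : v = p + q := by simp [hp, hq]
      have hsym : ∀ x y : HilbertL2, inner ℂ (P x) y = inner ℂ x (P y) :=
        ContinuousLinearMap.isSelfAdjoint_iff_isSymmetric.mp hPsa
      have hPP' : ∀ x, P (P x) = P x := fun x => congrArg (fun S : BoundedOps => S x) hPP
      have hpq : inner ℂ p q = 0 := by
        rw [hp, hq, hsym, map_sub, hPP', sub_self, inner_zero_right]
      have hnorm : ‖v‖ ^ 2 = ‖p‖ ^ 2 + ‖q‖ ^ 2 := by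
        rw [hv, sq, sq, sq]
        exact norm_add_sq_eq_norm_sq_add_norm_sq_of_inner_eq_zero _ _ hpq
      have hvq : (inner ℂ v q).re = ‖q‖ ^ 2 := by
        rw [hv, inner_add_left, hpq, zero_add]
        exact (norm_sq_eq_re_inner (𝕜 := ℂ) q).symm
      have hpT : (inner ℂ p (T p)).re ≤ ε * ‖p‖ ^ 2 := hc k p fun n hn => by
        rw [hp, hP]
        change a n * v n = 0
        rw [ha, indicatorSeq_apply, Set.indicator_of_notMem (by simpa using hn), zero_mul]
      have hqT : (inner ℂ q (T q)).re ≤ ‖q‖ ^ 2 := (abs_le.mp (abs_re_inner_le hT1 q)).2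
      have hmix : ∀ x y : HilbertL2, (inner ℂ x (T y)).re ≤ ‖x‖ * ‖y‖ := fun x y =>
        (Complex.re_le_norm _).trans ((norm_inner_le_norm _ _).trans
          (mul_le_mul_of_nonneg_left ((T.le_opNorm y).trans
            (mul_le_of_le_one_left (norm_nonneg _) hT1)) (norm_nonneg _)))
      have hTv : (inner ℂ v (T v)).re
          ≤ ε * ‖p‖ ^ 2 + 2 * (‖p‖ * ‖q‖) + ‖q‖ ^ 2 := by
        have e : inner ℂ v (T v) = inner ℂ p (T p) + inner ℂ p (T q) + inner ℂ q (T p)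
            + inner ℂ q (T q) := by
          conv_lhs => rw [hv]
          simp only [map_add, inner_add_left, inner_add_right]
          ring
        rw [e, Complex.add_re, Complex.add_re, Complex.add_re]
        linarith [hmix p q, hmix q p, mul_comm ‖p‖ ‖q‖]
      have hamgm : 2 * (‖p‖ * ‖q‖) ≤ ε * ‖p‖ ^ 2 + 1 / ε * ‖q‖ ^ 2 := by
        -- expand `(ε ‖p‖ - ‖q‖)² / ε ≥ 0`
        have h := mul_nonneg (one_div_pos.mpr hε0).le (sq_nonneg (ε * ‖p‖ - ‖q‖))
        have e : 1 / ε * (ε * ‖p‖ - ‖q‖) ^ 2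
            = ε * ‖p‖ ^ 2 - 2 * (‖p‖ * ‖q‖) + 1 / ε * ‖q‖ ^ 2 := by
          field_simp
          ring
        linarith
      have hvv : (inner ℂ v v).re = ‖v‖ ^ 2 := (norm_sq_eq_re_inner (𝕜 := ℂ) v).symm
      have hgoal : (inner ℂ v ((((2 * ε : ℝ) : ℂ) • (1 : BoundedOps) + ((K : ℝ) : ℂ) • (1 - P) - T) v)).re
          = 2 * ε * ‖v‖ ^ 2 + K * ‖q‖ ^ 2 - (inner ℂ v (T v)).re := by
        have e : (((2 * ε : ℝ) : ℂ) • (1 : BoundedOps) + ((K : ℝ) : ℂ) • (1 - P) - T) v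
            = ((2 * ε : ℝ) : ℂ) • v + ((K : ℝ) : ℂ) • q - T v := rfl
        rw [e, inner_sub_right, inner_add_right, inner_smul_right, inner_smul_right, Complex.sub_re,
          Complex.add_re, Complex.re_ofReal_mul, Complex.re_ofReal_mul, hvv, hvq]
      rw [hgoal, hnorm, hK]
      have hq0 : 0 ≤ ε * ‖q‖ ^ 2 := by positivity
      nlinarith
  have h := (Complex.nonneg_iff.mp hpos).1
  rw [map_sub, map_add, map_smul, map_smul, map_sub, hψ.2, hψP, sub_self, smul_zero, add_zero,
    smul_eq_mul, mul_one, Complex.sub_re, Complex.ofReal_re] at h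
  linarith

/-- Both `T` and `-T`, scaled to contractions, fall under the one-sided estimate. -/
lemma apply_eq_zero_of_diagonal_eq_zero_of_isSelfAdjoint (hφ : φ ∈ pureStates diagonalAlgebra)
    (hψ : ψ ∈ stateSpace BoundedOps) (hext : ∀ T : diagonalAlgebra, ψ (T : BoundedOps) = φ T)
    {T : BoundedOps} (hT : IsSelfAdjoint T) (hdiag : diagonalSeq T = 0) : ψ T = 0 := by
  set s : ℝ := (‖T‖ + 1)⁻¹ with hs
  have hs0 : 0 < s := by positivity
  have hsT : IsSelfAdjoint ((s : ℂ) • T) := IsSelfAdjoint.smul (Complex.conj_ofReal _) hT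
  have hs1 : ‖(s : ℂ) • T‖ ≤ 1 := by
    rw [norm_smul, Complex.norm_real, Real.norm_of_nonneg hs0.le, hs, inv_mul_le_iff₀ (by positivity)]
    linarith
  have hd : ∀ n, inner ℂ (lp.single 2 n (1 : ℂ) : HilbertL2) (T (lp.single 2 n (1 : ℂ))) = 0 :=
    fun n => by rw [← diagonalSeq_apply, hdiag]; rfl
  have hsd : diagonalSeq ((s : ℂ) • T) = 0 := by
    ext n
    rw [diagonalSeq_apply, _root_.smul_apply, inner_smul_right, hd, mul_zero]
    rfl
  have hsd' : diagonalSeq (-((s : ℂ) • T)) = 0 := by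
    ext n
    rw [diagonalSeq_apply, _root_.neg_apply, _root_.smul_apply,
      inner_neg_right, inner_smul_right, hd, mul_zero, neg_zero]
    rfl
  have h1 := re_apply_nonpos_of_diagonal_eq_zero hφ hψ hext hsT hs1 hsd
  have h2 := re_apply_nonpos_of_diagonal_eq_zero hφ hψ hext hsT.neg (by rwa [norm_neg]) hsd'
  -- `ψ (s T)` is real because `1 + s T` is positive
  have h3 : 0 ≤ ψ (1 + (s : ℂ) • T) := by
    refine apply_nonneg_of_mem_stateSpace hψ ((IsSelfAdjoint.one _).add hsT) fun v => ?_
    have h := (abs_le.mp (abs_re_inner_le hs1 v)).1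
    have hvv : (inner ℂ v v).re = ‖v‖ ^ 2 := (norm_sq_eq_re_inner (𝕜 := ℂ) v).symm
    rw [_root_.add_apply, inner_add_right, Complex.add_re, one_apply_eq_self, hvv]
    linarith
  have h4 := (Complex.nonneg_iff.mp h3).2
  rw [map_add, hψ.2, Complex.add_im, Complex.one_im, zero_add] at h4
  rw [map_neg, Complex.neg_re] at h2
  have h5 : ψ ((s : ℂ) • T) = 0 :=
    Complex.ext (le_antisymm h1 (by rw [Complex.zero_re]; linarith)) h4.symm
  rw [map_smul, smul_eq_zero] at h5
  exact h5.resolve_left (by exact_mod_cast hs0.ne')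

/-- A state extending a pure state `φ` of the diagonal algebra is the composition of `φ` with the
conditional expectation. -/
lemma eq_comp_diagonalExpectation (hφ : φ ∈ pureStates diagonalAlgebra)
    (hψ : ψ ∈ stateSpace BoundedOps) (hext : ∀ T : diagonalAlgebra, ψ (T : BoundedOps) = φ T) :
    ψ = φ.comp diagonalExpectation := by
  have hzero : ∀ S : BoundedOps, diagonalSeq S = 0 → ψ S = 0 := fun S hS => by
    have hd : ∀ n, inner ℂ (lp.single 2 n (1 : ℂ) : HilbertL2) (S (lp.single 2 n (1 : ℂ))) = 0 :=
      fun n => by rw [← diagonalSeq_apply, hS]; rfl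
    have hd' : ∀ n, inner ℂ (lp.single 2 n (1 : ℂ) : HilbertL2)
        (star S (lp.single 2 n (1 : ℂ))) = 0 := fun n => by
      rw [ContinuousLinearMap.star_eq_adjoint, ContinuousLinearMap.adjoint_inner_right,
        ← inner_conj_symm, hd, map_zero]
    have hre : ψ (realPart S : BoundedOps) = 0 :=
      apply_eq_zero_of_diagonal_eq_zero_of_isSelfAdjoint hφ hψ hext (realPart S).2 (by
        ext n
        change inner ℂ (lp.single 2 n (1 : ℂ) : HilbertL2) (((2⁻¹ : ℝ) : ℂ) • (S (lp.single 2 n (1 : ℂ))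
          + star S (lp.single 2 n (1 : ℂ)))) = 0
        rw [inner_smul_right, inner_add_right, hd, hd', add_zero, mul_zero])
    have him : ψ (imaginaryPart S : BoundedOps) = 0 :=
      apply_eq_zero_of_diagonal_eq_zero_of_isSelfAdjoint hφ hψ hext (imaginaryPart S).2 (by
        ext n
        change inner ℂ (lp.single 2 n (1 : ℂ) : HilbertL2) (-Complex.I • ((2⁻¹ : ℝ) : ℂ) •
          (S (lp.single 2 n (1 : ℂ)) - star S (lp.single 2 n (1 : ℂ)))) = 0
        rw [inner_smul_right, inner_smul_right, inner_sub_right, hd, hd',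
          sub_zero, mul_zero, mul_zero])
    rw [← realPart_add_I_smul_imaginaryPart S, map_add, map_smul, hre, him, smul_zero, add_zero]
  ext T
  have h := hzero (T - (diagonalExpectation T : BoundedOps)) (by
    ext n
    have e : diagonalSeq (diagonalExpectation T : BoundedOps) = diagonalSeq T :=
      diagonalSeq_diagonalRep _
    have e' := congrArg (fun a : ℓ^∞(ℕ, ℂ) => a n) e
    simp only [diagonalSeq_apply] at e'
    rw [diagonalSeq_apply, _root_.sub_apply, inner_sub_right, e', sub_self]
    rfl)
  rw [map_sub, sub_eq_zero] at h
  rw [h, hext]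
  rfl

end Uniqueness

theorem mainTheorem1 (φ : diagonalAlgebra →L[ℂ] ℂ) (hφ : φ ∈ pureStates diagonalAlgebra) :
    (∃! ψ : BoundedOps →L[ℂ] ℂ,
      ψ ∈ stateSpace BoundedOps ∧ ∀ T : diagonalAlgebra, ψ (T : BoundedOps) = φ T) ∧
    (∀ ψ : BoundedOps →L[ℂ] ℂ,
      ψ ∈ stateSpace BoundedOps → (∀ T : diagonalAlgebra, ψ (T : BoundedOps) = φ T) →
        ψ ∈ pureStates BoundedOps) := by
  refine ⟨⟨φ.comp diagonalExpectation, ⟨comp_diagonalExpectation_mem_stateSpace hφ.1, fun T => ?_⟩,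
    fun ψ hψ => eq_comp_diagonalExpectation hφ hψ.1 hψ.2⟩, fun ψ hψ hext => ?_⟩
  · rw [ContinuousLinearMap.comp_apply, diagonalExpectation_coe]
  · refine mem_extremePoints.mpr ⟨hψ, fun ψ₁ h₁ ψ₂ h₂ hseg => ?_⟩
    -- the restrictions to the diagonal algebra decompose `φ`, so both are equal to `φ`
    let ι : diagonalAlgebra →L[ℂ] BoundedOps :=
      ⟨diagonalAlgebra.subtype.toAlgHom.toLinearMap, continuous_subtype_val⟩
    have hι : ∀ χ ∈ stateSpace BoundedOps, χ.comp ι ∈ stateSpace diagonalAlgebra := fun χ hχ =>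
      ⟨fun x => hχ.1 (x : BoundedOps), hχ.2⟩
    have hφseg : φ ∈ openSegment ℝ (ψ₁.comp ι) (ψ₂.comp ι) := by
      obtain ⟨s, t, hs, ht, hst, rfl⟩ := hseg
      refine ⟨s, t, hs, ht, hst, ?_⟩
      ext T
      exact hext T
    obtain ⟨e₁, e₂⟩ := (mem_extremePoints.mp hφ).2 _ (hι ψ₁ h₁) _ (hι ψ₂ h₂) hφseg
    have hψ' := eq_comp_diagonalExpectation hφ hψ hext
    exact ⟨(eq_comp_diagonalExpectation hφ h₁ fun T => congrArg (fun χ => χ T) e₁).trans hψ'.symm,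
      (eq_comp_diagonalExpectation hφ h₂ fun T => congrArg (fun χ => χ T) e₂).trans hψ'.symm⟩
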